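/- Let $(X,d)$ be a compact metric space and let $f\colon X\to X$ be a continuous map with the shadowing property. Then the following conditions are equivalent: (1) $f$ is totally transitive; (2) $f$ is topologically weakly mixing; (3) $f$ is topologically mixing; (4) $f$ is surjective and has the specification property; (5) $f$ is surjective and has the almost specification property; (6) $f$ is surjective and has the asymptotic average shadowing property; (7) $f$ is surjective and has the average shadowing property. Moreover, if $f$ is c-expansive, then each of these conditions is equivalent to: (8) $f$ has the periodic specification property. Here the notions are the following. - $f$ has the shadowing property if for every $\varepsilon>0$ there is $\delta>0$ such that for every sequence $(x_i)_{i\ge 0}$ in $X$ with $d(f(x_i),x_{i+1})<\delta$ for all $i$ there is $z\in X$ with $d(f^i(z),x_i)<\varepsilon$ for all $i\ge 0$. - $f$ is transitive if for all nonempty open $U,V\subset X$ there is $n>0$ with $f^n(U)\cap V\ne\emptyset$; totally transitive if $f^n$ is transitive for every $n\ge1$; weakly mixing if $f\times f$ is transitive on $X\times X$; mixing if for all nonempty open $U,V$ there is $N>0$ with $f^n(U)\cap V\neq\emptyset$ for all $n\ge N$. - $f$ has the specification property if for every $\varepsilon>0$ there is an integer $N>0$ such that for all $s\ge 0$, all $y_0,\dots,y_s\in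 X$ and all integers $0\le j_0\le k_0<j_1\le k_1<\dots<j_s\le k_s$ with $j_{m+1}-k_m\ge N$ for $0\le m<s$ there is $x\in X$ with $d(f^i(x),f^i(y_m))<\varepsilon$ whenever $0\le m\le s$ and $j_m\le i\le k_m$. It has the periodic specification property if moreover, for every integer $p\ge N+k_s-j_0$, such an $x$ can be chosen with $f^p(x)=x$. - A mistake function is a map $g\colon\{1,2,\dots\}\times(0,\varepsilon_0]\to\{0,1,2,\dots\}$, for some $\varepsilon_0>0$, with $g(n,\varepsilon)\le g(n+1,\varepsilon)$ and $\lim_{n\to\infty}g(n,\varepsilon)/n=0$ for all $\varepsilon\in(0,\varepsilon_0]$ and $n\geq 1$; put $g(n,\varepsilon)=g(n,\varepsilon_0)$ for $\varepsilon>\varepsilon_0$. If $g(n,\varepsilon)<n$, let $B_n(g;x,\varepsilon)$ be the set of $y\in X$ for which there is $\Lambda\subset\{0,\dots,n-1\}$ with $\#\Lambda\ge n-g(n,\varepsilon)$ and $d(f^i(x),f^i(y))<\varepsilon$ for all $i\in\Lambda$. The map $f$ has the almost specification property if there are a mistake function $g$ and a function $k_g\colon(0,\infty)\to\{0,1,2,\dots\}$,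 with $g(n,\varepsilon)<n$ for all $\varepsilon>0$ and $n\ge k_g(\varepsilon)$, such that for all $m\ge1$, $\varepsilon_1,\dots,\varepsilon_m>0$, $x_1,\dots,x_m\in X$ and integers $n_j\ge k_g(\varepsilon_j)$ $(1\le j\le m)$ there is $z\in X$ with $f^{l_j}(z)\in B_{n_j}(g;x_j,\varepsilon_j)$ for $j=1,\dots,m$, where $l_j=n_1+\dots+n_{j-1}$ (so $l_1=0$). - $(x_i)_{i\ge0}$ is a $\delta$-average-pseudo-orbit if there is $N>0$ such that $\frac1n\sum_{i=0}^{n-1}d(f(x_{i+k}),x_{i+k+1})<\delta$ for all $n\ge N$ and $k\ge0$. The map $f$ has the average shadowing property if for every $\varepsilon>0$ there is $\delta>0$ such that for every $\delta$-average-pseudo-orbit $(x_i)$ there is $y\in X$ with $\limsup_{n\to\infty}\frac1n\sum_{i=0}^{n-1}d(f^i(y),x_i)<\varepsilon$. - $f$ has the asymptotic average shadowing property if for every sequence $(x_i)_{i\ge0}$ in $X$ with $\lim_{n\to\infty}\frac1n\sum_{i=0}^{n-1}d(f(x_i),x_{i+1})=0$ there is $y\in X$ with $\lim_{n\to\infty}\frac1n\sum_{i=0}^{n-1}d(f^i(y),x_i)=0$.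 - $f$ is c-expansive if there is $\beta>0$ such that any two two-sided sequences $(x_n)_{n\in\mathbb Z}$, $(y_n)_{n\in\mathbb Z}$ in $X$ with $f(x_n)=x_{n+1}$, $f(y_n)=y_{n+1}$ and $d(x_n,y_n)\le\beta$ for all $n\in\mathbb Z$ are equal. -/

import Mathlib

open Filter Topology

namespace ShadowingDynamics

section TopologicalNotions

variable {X : Type*} [TopologicalSpace X]

/-- `f` is (topologically) transitive: for all nonempty open `U`, `V` there is `n > 0` with
`f^n(U) ∩ V ≠ ∅`. -/
def Transitive (f : X → X) : Prop :=
  ∀ U V : Set X, IsOpen U → U.Nonempty → IsOpen V → V.Nonempty →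
    ∃ n : ℕ, 0 < n ∧ ((f^[n] '' U) ∩ V).Nonempty

/-- `f` is totally transitive: `f^n` is transitive for all `n ≥ 1`. -/
def TotallyTransitive (f : X → X) : Prop :=
  ∀ n : ℕ, 1 ≤ n → Transitive (f^[n])

/-- `f` is (topologically) weakly mixing: `f × f` is transitive on `X × X`. -/
def WeaklyMixing (f : X → X) : Prop :=
  Transitive (Prod.map f f)

/-- `f` is (topologically) mixing: for all nonempty open `U`, `V` there is `N > 0` with
`f^n(U) ∩ V ≠ ∅` for all `n ≥ N`. -/
def Mixing (f : X → X) : Prop :=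
  ∀ U V : Set X, IsOpen U → U.Nonempty → IsOpen V → V.Nonempty →
    ∃ N : ℕ, 0 < N ∧ ∀ n : ℕ, N ≤ n → ((f^[n] '' U) ∩ V).Nonempty

end TopologicalNotions

section MetricNotions

variable {X : Type*} [MetricSpace X]

/-- The sequence `x` is a `δ`-pseudo-orbit of `f`. -/
def IsPseudoOrbit (f : X → X) (δ : ℝ) (x : ℕ → X) : Prop :=
  ∀ i : ℕ, dist (f (x i)) (x (i + 1)) < δ

/-- The shadowing (pseudo-orbit tracing) property: for every `ε > 0` there is `δ > 0` such that
every `δ`-pseudo-orbit is `ε`-traced by the orbit of some point. -/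
def Shadowing (f : X → X) : Prop :=
  ∀ ε : ℝ, 0 < ε → ∃ δ : ℝ, 0 < δ ∧ ∀ x : ℕ → X, IsPseudoOrbit f δ x →
    ∃ z : X, ∀ i : ℕ, dist (f^[i] z) (x i) < ε

/-- Orbit segments are prescribed on the time windows `[j 0, k 0], …, [j s, k s]`; any two
consecutive windows are at least `N` apart. -/
def IsSpaced (N s : ℕ) (j k : ℕ → ℕ) : Prop :=
  (∀ m : ℕ, m ≤ s → j m ≤ k m) ∧ ∀ m : ℕ, m < s → k m + N ≤ j (m + 1)

/-- The point `x` `ε`-traces the orbit of `y m` on the time window `[j m, k m]`,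
for `m = 0, …, s`. -/
def Traces (f : X → X) (ε : ℝ) (s : ℕ) (y : ℕ → X) (j k : ℕ → ℕ) (x : X) : Prop :=
  ∀ m : ℕ, m ≤ s → ∀ i : ℕ, j m ≤ i → i ≤ k m → dist (f^[i] x) (f^[i] (y m)) < ε

/-- The specification property. Only the values of `y`, `j`, `k` at `0, …, s` matter. -/
def Specification (f : X → X) : Prop :=
  ∀ ε : ℝ, 0 < ε → ∃ N : ℕ, 0 < N ∧
    ∀ (s : ℕ) (y : ℕ → X) (j k : ℕ → ℕ), IsSpaced N s j k →
      ∃ x : X, Traces f ε s y j k x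

/-- The periodic specification property: the tracing point can moreover be chosen periodic, with
any prescribed period `p ≥ N + (k s - j 0)`. -/
def PeriodicSpecification (f : X → X) : Prop :=
  ∀ ε : ℝ, 0 < ε → ∃ N : ℕ, 0 < N ∧
    ∀ (s : ℕ) (y : ℕ → X) (j k : ℕ → ℕ), IsSpaced N s j k →
      ∀ p : ℕ, N + k s ≤ p + j 0 →
        ∃ x : X, Traces f ε s y j k x ∧ f^[p] x = x

/-- `g` restricted to positive integers and to `(0, ε₀]` is a mistake function. -/
def IsMistakeFunction (ε₀ : ℝ) (g : ℕ → ℝ → ℕ) : Prop :=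
  0 < ε₀ ∧ ∀ ε : ℝ, 0 < ε → ε ≤ ε₀ →
    (∀ n : ℕ, 1 ≤ n → g n ε ≤ g (n + 1) ε) ∧
      Tendsto (fun n : ℕ => (g n ε : ℝ) / (n : ℝ)) atTop (𝓝 0)

/-- The extension of a mistake function to all `ε > 0`: it is `g (n, ε₀)` for `ε > ε₀`. -/
noncomputable def mistakeExt (ε₀ : ℝ) (g : ℕ → ℝ → ℕ) (n : ℕ) (ε : ℝ) : ℕ :=
  g n (min ε ε₀)

/-- The Bowen ball of radius `ε` centred at `x` along the finite set of times `Λ`. -/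
def bowenBall (f : X → X) (Λ : Finset ℕ) (x : X) (ε : ℝ) : Set X :=
  {y | ∀ i ∈ Λ, dist (f^[i] x) (f^[i] y) < ε}

/-- The Bowen ball of radius `ε`, centre `x` and length `n` with at most `q` mistakes: the union
of the Bowen balls along the sets `Λ ⊆ {0, …, n - 1}` with at least `n - q` elements. -/
def mistakeBall (f : X → X) (n q : ℕ) (x : X) (ε : ℝ) : Set X :=
  {y | ∃ Λ : Finset ℕ, Λ ⊆ Finset.range n ∧ n ≤ Λ.card + q ∧ y ∈ bowenBall f Λ x ε}

/-- The almost specification property. The requirement `mistakeExt ε₀ g n ε < n` for `n ≥ κ ε`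
says that the Bowen balls with mistakes that occur in it are defined. -/
def AlmostSpecification (f : X → X) : Prop :=
  ∃ (ε₀ : ℝ) (g : ℕ → ℝ → ℕ) (κ : ℝ → ℕ), IsMistakeFunction ε₀ g ∧
    (∀ ε : ℝ, 0 < ε → ∀ n : ℕ, κ ε ≤ n → mistakeExt ε₀ g n ε < n) ∧
    ∀ (m : ℕ) (ε : ℕ → ℝ) (x : ℕ → X) (n : ℕ → ℕ), 1 ≤ m →
      (∀ j : ℕ, j < m → 0 < ε j) → (∀ j : ℕ, j < m → κ (ε j) ≤ n j) →
        ∃ z : X, ∀ j : ℕ, j < m →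
          f^[∑ s ∈ Finset.range j, n s] z ∈
            mistakeBall f (n j) (mistakeExt ε₀ g (n j) (ε j)) (x j) (ε j)

/-- The sequence `x` is a `δ`-average-pseudo-orbit of `f`. -/
def IsAveragePseudoOrbit (f : X → X) (δ : ℝ) (x : ℕ → X) : Prop :=
  ∃ N : ℕ, 0 < N ∧ ∀ n k : ℕ, N ≤ n →
    (1 / (n : ℝ)) * ∑ i ∈ Finset.range n, dist (f (x (i + k))) (x (i + k + 1)) < δ

/-- The sequence `x` is `ε`-shadowed in average by `y`. (The averages are bounded when `X` is
compact, so the real `limsup` is the usual one.) -/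
def ShadowedInAverage (f : X → X) (ε : ℝ) (x : ℕ → X) (y : X) : Prop :=
  limsup (fun n : ℕ => (1 / (n : ℝ)) * ∑ i ∈ Finset.range n, dist (f^[i] y) (x i)) atTop < ε

/-- The average shadowing property. -/
def AverageShadowing (f : X → X) : Prop :=
  ∀ ε : ℝ, 0 < ε → ∃ δ : ℝ, 0 < δ ∧ ∀ x : ℕ → X, IsAveragePseudoOrbit f δ x →
    ∃ y : X, ShadowedInAverage f ε x y

/-- The sequence `x` is an asymptotic average pseudo-orbit of `f`. -/
def IsAsymptoticAveragePseudoOrbit (f : X → X) (x : ℕ → X) : Prop :=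
  Tendsto (fun n : ℕ => (1 / (n : ℝ)) * ∑ i ∈ Finset.range n, dist (f (x i)) (x (i + 1)))
    atTop (𝓝 0)

/-- The sequence `x` is asymptotically shadowed in average by `y`. -/
def AsymptoticallyShadowedInAverage (f : X → X) (x : ℕ → X) (y : X) : Prop :=
  Tendsto (fun n : ℕ => (1 / (n : ℝ)) * ∑ i ∈ Finset.range n, dist (f^[i] y) (x i))
    atTop (𝓝 0)

/-- The asymptotic average shadowing property. -/
def AsymptoticAverageShadowing (f : X → X) : Prop :=
  ∀ x : ℕ → X, IsAsymptoticAveragePseudoOrbit f x →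
    ∃ y : X, AsymptoticallyShadowedInAverage f x y

/-- `f` is c-expansive: there is `β > 0` such that two full (two-sided) orbits of `f` which stay
within `β` of each other at all times coincide. -/
def CExpansive (f : X → X) : Prop :=
  ∃ β : ℝ, 0 < β ∧ ∀ x y : ℤ → X,
    (∀ n : ℤ, f (x n) = x (n + 1)) → (∀ n : ℤ, f (y n) = y (n + 1)) →
      (∀ n : ℤ, dist (x n) (y n) ≤ β) → x = y

end MetricNotions

end ShadowingDynamics

/-! Mixing is the hub of all the equivalences. A shadowed chain is an orbit, so under shadowing it
suffices for mixing to join any two points by `δ`-chains of every large length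
(`ChainMixing.mixing`). Total transitivity, weak mixing, almost specification and the average
properties each give such chains: some true orbit passes near the orbits of both points, and one
jumps onto it and off again. What remains is control of the length, usually through loops of coprime
lengths (`Chain.eventually`). Surjectivity lets a segment be chosen to end at a given point. Both
average properties enter only through `WeakAverageShadowing`; specification gives mixing directly.

Conversely, mixing and compactness make the chain lengths uniform in the end points
(`Mixing.exists_forall_chain`), so prescribed orbit segments fit into one pseudo-orbit, and
shadowing it gives specification. If the pseudo-orbit is periodic, c-expansivity makes the shadowing
two-sided orbit periodic.

Almost specification and the average properties need infinitely many segments traced with different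
precisions, where the transition time of a segment depends on its own precision only. This is
`Mixing.exists_glued`: finer segments are fitted between coarser ones already glued, and the
successive shadowing errors form a geometric series. -/

namespace ShadowingDynamics

/-! ### Chains, chain mixing, and conditions that imply it -/

section Chains

variable {X : Type*} [MetricSpace X] {f : X → X} {δ : ℝ} {x y z : X} {m n : ℕ}

/-- There is a `δ`-chain of length `n` from `x` to `y`. -/
def Chain (f : X → X) (δ : ℝ) (x y : X) (n : ℕ) : Prop :=
  ∃ u : ℕ → X, u 0 = x ∧ u n = y ∧ ∀ i < n, dist (f (u i)) (u (i + 1)) < δ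

theorem chain_iterate (hδ : 0 < δ) (x : X) (n : ℕ) : Chain f δ x (f^[n] x) n :=
  ⟨fun i => f^[i] x, rfl, rfl, fun i _ => by simpa [Function.iterate_succ_apply'] using hδ⟩

theorem Chain.trans (h₁ : Chain f δ x y m) (h₂ : Chain f δ y z n) : Chain f δ x z (m + n) := by
  obtain ⟨u, hu0, hum, hu⟩ := h₁
  obtain ⟨v, hv0, hvn, hv⟩ := h₂
  refine ⟨fun i => if i < m then u i else v (i - m), ?_, by simp [hvn], fun i hi => ?_⟩
  · rcases Nat.eq_zero_or_pos m with rfl | hm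
    · simp [hv0, ← hum, hu0]
    · simp [hm, hu0]
  · rcases lt_trichotomy (i + 1) m with h | h | h
    · have h' : i < m := by omega
      simpa [h, h'] using hu i h'
    · have h' : i < m := by omega
      have := hu i h'
      rw [h, hum, ← hv0] at this
      simpa [h, h'] using this
    · have h' : ¬ i < m := by omega
      have h'' : ¬ i + 1 < m := by omega
      have := hv (i - m) (by omega)
      simpa [h', h'', show i + 1 - m = i - m + 1 by omega] using this

theorem Chain.mul (h : Chain f δ x x n) (m : ℕ) : Chain f δ x x (m * n) := by
  induction m with
  | zero => exact ⟨fun _ => x, rfl, rfl, fun i hi => by omega⟩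
  | succ m ih => simpa [Nat.succ_mul] using ih.trans h

/-- Chains through a single orbit whose end points have been moved slightly. -/
theorem exists_chain_of_orbit [CompactSpace X] (hf : Continuous f) (hδ : 0 < δ) :
    ∃ η > 0, ∀ (x y u : X) (n : ℕ), 0 < n → dist x u < η → dist y (f^[n] u) < η →
      Chain f δ x y n := by
  obtain ⟨η, hη, h⟩ := Metric.uniformContinuous_iff.1
    (CompactSpace.uniformContinuous_of_continuous hf) (δ / 2) (by positivity)
  refine ⟨min η (δ / 2), by positivity, fun x y u n hn hx hy => ?_⟩
  let v : ℕ → X := fun i => if i = 0 then x else if i = n then y else f^[i] u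
  have hv : ∀ i, dist (v i) (f^[i] u) < min η (δ / 2) := by
    intro i
    by_cases hi : i = 0
    · simpa [v, hi] using hx
    · by_cases hin : i = n
      · subst hin
        simpa [v, hi] using hy
      · simp [v, hi, hin, hη, hδ]
  refine ⟨v, by simp [v], by simp [v, hn.ne'], fun i _ => ?_⟩
  have h₁ := h ((hv i).trans_le (min_le_left _ _))
  have h₂ := (hv (i + 1)).trans_le (min_le_right _ _)
  rw [← Function.iterate_succ_apply' f] at h₁
  rw [dist_comm] at h₂
  linarith [dist_triangle (f (v i)) (f^[i + 1] u) (v (i + 1))]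

/-- Chains of all sufficiently large lengths join any two points. -/
def ChainMixing (f : X → X) : Prop :=
  ∀ δ : ℝ, 0 < δ → ∀ x y : X, ∃ N : ℕ, ∀ n ≥ N, Chain f δ x y n

/-- The loop lengths `n` and `n * k + 1` are coprime: `m % n` turns of the long loop produce the
residue of `m`, and turns of the short one fill up the rest. -/
theorem Chain.eventually {k : ℕ} (hn : 0 < n) (h₁ : Chain f δ x x n)
    (h₂ : Chain f δ x x (n * k + 1)) : ∃ N : ℕ, ∀ m ≥ N, Chain f δ x x m := by
  refine ⟨n * (n * k), fun m hm => ?_⟩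
  have hr : m % n < n := Nat.mod_lt _ hn
  have hq : n * k ≤ m / n := (Nat.le_div_iff_mul_le hn).2 (by linarith [mul_comm n (n * k)])
  have hrk : m % n * k ≤ m / n := (Nat.mul_le_mul_right k hr.le).trans hq
  obtain ⟨q, hq'⟩ := Nat.exists_eq_add_of_le hrk
  have hm' : m = m % n * (n * k + 1) + q * n := by
    conv_lhs => rw [← Nat.mod_add_div m n, hq']
    ring
  rw [hm']
  exact (h₂.mul _).trans (h₁.mul _)

theorem chainMixing_of_eventually (h : ∀ δ : ℝ, 0 < δ → ∀ x y : X, ∃ n, Chain f δ x y n)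
    (h' : ∀ δ : ℝ, 0 < δ → ∀ x : X, ∃ N : ℕ, ∀ m ≥ N, Chain f δ x x m) : ChainMixing f := by
  intro δ hδ x y
  obtain ⟨n, hn⟩ := h δ hδ x y
  obtain ⟨N, hN⟩ := h' δ hδ x
  refine ⟨N + n, fun m hm => ?_⟩
  rw [show m = (m - n) + n by omega]
  exact (hN _ (by omega)).trans hn

/-- With a loop of length `k` at `x`, a chain from `f x` back to `x` of length divisible by `k`,
preceded by the step `x ↦ f x`, is a loop of length `1` modulo `k`. -/
theorem chainMixing_of_mul (h : ∀ δ : ℝ, 0 < δ → ∀ (x y : X) (p : ℕ), 0 < p →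
    ∃ k > 0, Chain f δ x y (p * k)) : ChainMixing f := by
  refine chainMixing_of_eventually (fun δ hδ x y => ?_) fun δ hδ x => ?_
  · obtain ⟨k, -, hk⟩ := h δ hδ x y 1 one_pos
    exact ⟨_, hk⟩
  · obtain ⟨k, hk, hkx⟩ := h δ hδ x x 1 one_pos
    obtain ⟨l, hl, hlx⟩ := h δ hδ (f x) x (1 * k) (by omega)
    have := (chain_iterate (f := f) hδ x 1).trans hlx
    rw [add_comm] at this
    exact Chain.eventually (by omega) hkx this

theorem ChainMixing.mixing (h : ChainMixing f) (hsh : Shadowing f) : Mixing f := by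
  rintro U V hU ⟨x, hx⟩ hV ⟨y, hy⟩
  obtain ⟨ε₁, hε₁, hxU⟩ := Metric.isOpen_iff.1 hU x hx
  obtain ⟨ε₂, hε₂, hyV⟩ := Metric.isOpen_iff.1 hV y hy
  obtain ⟨δ, hδ, hδs⟩ := hsh (min ε₁ ε₂) (by positivity)
  obtain ⟨N, hN⟩ := h δ hδ x y
  refine ⟨N + 1, by omega, fun n hn => ?_⟩
  obtain ⟨u, hu0, hun, hu⟩ := hN n (by omega)
  -- The finite chain is prolonged by the true orbit of `y`, so that shadowing applies.
  obtain ⟨z, hz⟩ := hδs (fun i => if i < n then u i else f^[i - n] y) (fun i => by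
    rcases lt_trichotomy (i + 1) n with h | h | h
    · have h' : i < n := by omega
      simpa [h, h'] using hu i h'
    · have h' : i < n := by omega
      have := hu i h'
      rw [h, hun] at this
      simpa [h, h'] using this
    · have h' : ¬ i < n := by omega
      have h'' : ¬ i + 1 < n := by omega
      simpa [h', h'', show i + 1 - n = i - n + 1 by omega, Function.iterate_succ_apply'] using hδ)
  refine ⟨f^[n] z, ⟨z, hxU ?_, rfl⟩, hyV ?_⟩
  · have := hz 0
    rw [if_pos (by omega), hu0] at this
    exact this.trans_le (min_le_left _ _)
  · have := hz n
    simp only [lt_self_iff_false, if_false, Nat.sub_self, Function.iterate_zero, id] at this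
    exact this.trans_le (min_le_right _ _)

theorem TotallyTransitive.chainMixing [CompactSpace X] (hf : Continuous f)
    (h : TotallyTransitive f) : ChainMixing f := by
  refine chainMixing_of_mul fun δ hδ x y p hp => ?_
  obtain ⟨η, hη, hc⟩ := exists_chain_of_orbit hf hδ
  obtain ⟨n, hn, _, ⟨u, hu, rfl⟩, hv⟩ := h p hp (Metric.ball x η) (Metric.ball y η)
    Metric.isOpen_ball ⟨x, Metric.mem_ball_self hη⟩ Metric.isOpen_ball ⟨y, Metric.mem_ball_self hη⟩
  rw [← Function.iterate_mul] at hv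
  exact ⟨n, hn, hc x y u _ (by positivity) (Metric.mem_ball'.1 hu) (Metric.mem_ball'.1 hv)⟩

theorem WeaklyMixing.exists_iterate (h : WeaklyMixing f) (x y x' y' : X) {η : ℝ} (hη : 0 < η) :
    ∃ n > 0, ∃ u v : X, dist x u < η ∧ dist y (f^[n] u) < η ∧
      dist x' v < η ∧ dist y' (f^[n] v) < η := by
  have hb (a : X) : (Metric.ball a η).Nonempty := ⟨a, Metric.mem_ball_self hη⟩
  obtain ⟨n, hn, _, ⟨⟨u, v⟩, ⟨hu, hv⟩, rfl⟩, hw⟩ :=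
    h (Metric.ball x η ×ˢ Metric.ball x' η) (Metric.ball y η ×ˢ Metric.ball y' η)
      (Metric.isOpen_ball.prod Metric.isOpen_ball) ((hb x).prod (hb x'))
      (Metric.isOpen_ball.prod Metric.isOpen_ball) ((hb y).prod (hb y'))
  rw [Prod.map_iterate] at hw
  exact ⟨n, hn, u, v, Metric.mem_ball'.1 hu, Metric.mem_ball'.1 hw.1, Metric.mem_ball'.1 hv,
    Metric.mem_ball'.1 hw.2⟩

/-- Transitivity of the product gives chains of the same length `n` from `f x` and from `f^[2] x` to
`x`, hence loops at `x` of the consecutive lengths `n + 1` and `n + 2`. -/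
theorem WeaklyMixing.chainMixing [CompactSpace X] (hf : Continuous f)
    (h : WeaklyMixing f) : ChainMixing f := by
  refine chainMixing_of_eventually (fun δ hδ x y => ?_) fun δ hδ x => ?_ <;>
    obtain ⟨η, hη, hc⟩ := exists_chain_of_orbit hf hδ
  · obtain ⟨n, hn, u, _, hu, hu', -⟩ := h.exists_iterate x y x y hη
    exact ⟨n, hc x y u n hn hu hu'⟩
  · obtain ⟨n, hn, u, v, hu, hu', hv, hv'⟩ := h.exists_iterate (f x) x (f^[2] x) x hη
    have h₁ := (chain_iterate (f := f) hδ x 1).trans (hc _ _ u n hn hu hu')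
    have h₂ := (chain_iterate (f := f) hδ x 2).trans (hc _ _ v n hn hv hv')
    refine Chain.eventually (k := 1) (by omega) h₁ ?_
    convert h₂ using 1
    omega

/-- Two segments are prescribed: `κ η` steps from `x`, then `n` steps from a point `y'` with `f^[n]
y' = y`. Each has a time without mistake, where the chain can enter and leave the orbit of `z`. The
length is `κ η + n` wherever these times lie. -/
theorem AlmostSpecification.chainMixing [CompactSpace X] (hf : Continuous f)
    (hs : Function.Surjective f) (h : AlmostSpecification f) : ChainMixing f := by
  intro δ hδ x y
  obtain ⟨η, hη, hc⟩ := exists_chain_of_orbit hf hδ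
  obtain ⟨ε₀, g, κ, -, hκ, hspec⟩ := h
  have key : ∀ (n : ℕ) (a b : X), κ η ≤ n →
      b ∈ mistakeBall f n (mistakeExt ε₀ g n η) a η → ∃ i < n, dist (f^[i] a) (f^[i] b) < η := by
    rintro n a b hn ⟨Λ, hΛ, hcard, hb⟩
    have := hκ η hη n hn
    obtain ⟨i, hi⟩ : Λ.Nonempty := Finset.card_pos.1 (by omega)
    exact ⟨i, Finset.mem_range.1 (hΛ hi), hb i hi⟩
  refine ⟨κ η + κ η, fun N hN => ?_⟩
  obtain ⟨n, rfl⟩ := Nat.exists_eq_add_of_le (show κ η ≤ N by omega)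
  obtain ⟨y', hy'⟩ := hs.iterate n y
  obtain ⟨z, hz⟩ := hspec 2 (fun _ => η) (fun j => if j = 0 then x else y')
    (fun j => if j = 0 then κ η else n) (by norm_num) (fun _ _ => hη)
    (fun j _ => by split_ifs <;> omega)
  obtain ⟨i, hi, hix⟩ := key _ _ _ le_rfl (hz 0 (by norm_num))
  have h1 := hz 1 (by norm_num)
  simp only [one_ne_zero, if_false, Finset.sum_range_one, if_true] at h1
  obtain ⟨j, hj, hjy⟩ := key _ _ _ (by omega) h1
  simp only [Finset.range_zero, Finset.sum_empty, Function.iterate_zero, id, if_true] at hix hi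
  rw [← Function.iterate_add_apply] at hjy
  have hc' := hc (f^[i] x) (f^[j] y') (f^[i] z) (κ η + j - i) (by omega) hix (by
    rwa [← Function.iterate_add_apply, show κ η + j - i + i = j + κ η by omega])
  have hfin := ((chain_iterate (f := f) hδ x i).trans hc').trans (chain_iterate hδ _ (n - j))
  rw [← Function.iterate_add_apply, show n - j + j = n by omega, hy'] at hfin
  convert hfin using 1
  omega

end Chains

/-! ### Consequences of mixing -/

section Mixing

variable {X : Type*} [MetricSpace X] {f : X → X}

theorem Mixing.totallyTransitive (h : Mixing f) : TotallyTransitive f := by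
  intro n hn U V hU hU' hV hV'
  obtain ⟨N, hN, hUV⟩ := h U V hU hU' hV hV'
  refine ⟨N, hN, ?_⟩
  rw [← Function.iterate_mul]
  exact hUV _ (Nat.le_mul_of_pos_left N hn)

theorem Mixing.weaklyMixing (h : Mixing f) : WeaklyMixing f := by
  rintro U V hU ⟨⟨x, x'⟩, hx⟩ hV ⟨⟨y, y'⟩, hy⟩
  obtain ⟨u, u', hu, hu', hxu, hxu', huu⟩ := isOpen_prod_iff.1 hU x x' hx
  obtain ⟨v, v', hv, hv', hyv, hyv', hvv⟩ := isOpen_prod_iff.1 hV y y' hy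
  obtain ⟨N, hN, h₁⟩ := h u v hu ⟨x, hxu⟩ hv ⟨y, hyv⟩
  obtain ⟨N', hN', h₂⟩ := h u' v' hu' ⟨x', hxu'⟩ hv' ⟨y', hyv'⟩
  obtain ⟨_, ⟨a, ha, rfl⟩, hb⟩ := h₁ (N + N') (by omega)
  obtain ⟨_, ⟨a', ha', rfl⟩, hb'⟩ := h₂ (N + N') (by omega)
  refine ⟨N + N', by omega, (f^[N + N'] a, f^[N + N'] a'), ⟨(a, a'), huu ⟨ha, ha'⟩, ?_⟩,
    hvv ⟨hb, hb'⟩⟩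
  rw [Prod.map_iterate]
  rfl

theorem Mixing.surjective [CompactSpace X] (hf : Continuous f) (h : Mixing f) :
    Function.Surjective f := by
  have hd : DenseRange f := by
    refine dense_iff_inter_open.2 fun U hU hU' => ?_
    obtain ⟨N, hN, hUU⟩ := h U U hU hU' hU hU'
    obtain ⟨_, ⟨a, -, rfl⟩, hb⟩ := hUU N le_rfl
    refine ⟨_, hb, f^[N - 1] a, ?_⟩
    rw [← Function.iterate_succ_apply' f, show (N - 1).succ = N by omega]
  have hc : IsClosed (Set.range f) := (isCompact_range hf).isClosed
  rw [← Set.range_eq_univ, ← hc.closure_eq]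
  exact hd.closure_eq

/-- Mixing times are needed only for the finitely many pairs of balls centred at a finite `η /
2`-net, so they have a common bound. -/
theorem Mixing.exists_forall_chain [CompactSpace X] (hf : Continuous f) (h : Mixing f)
    {δ : ℝ} (hδ : 0 < δ) : ∃ N > 0, ∀ n ≥ N, ∀ x y : X, Chain f δ x y n := by
  obtain ⟨η, hη, hc⟩ := exists_chain_of_orbit hf hδ
  obtain ⟨t, -, ht, htc⟩ := Metric.totallyBounded_iff.1
    (isCompact_univ (X := X)).totallyBounded (η / 2) (by positivity) |>.imp
      fun t ht => (⟨trivial, ht.1, ht.2⟩ : True ∧ _ ∧ _)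
  choose M hM hMc using fun a b : X => h (Metric.ball a (η / 2)) (Metric.ball b (η / 2))
    Metric.isOpen_ball ⟨a, Metric.mem_ball_self (by positivity)⟩ Metric.isOpen_ball
    ⟨b, Metric.mem_ball_self (by positivity)⟩
  obtain ⟨N, hN⟩ := ((ht.prod ht).image fun q => M q.1 q.2).bddAbove
  refine ⟨N + 1, by omega, fun n hn x y => ?_⟩
  obtain ⟨a, ha, hxa⟩ := Set.mem_iUnion₂.1 (htc (Set.mem_univ x))
  obtain ⟨b, hb, hyb⟩ := Set.mem_iUnion₂.1 (htc (Set.mem_univ y))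
  have := hN ⟨(a, b), ⟨ha, hb⟩, rfl⟩
  obtain ⟨_, ⟨u, hu, rfl⟩, hv⟩ := hMc a b n (by simp only at this; omega)
  rw [Metric.mem_ball] at hxa hyb hu hv
  exact hc x y u n (by omega) (by linarith [dist_triangle_right x u a])
    (by linarith [dist_triangle_right y (f^[n] u) b])

end Mixing

/-! ### From average shadowing to chain mixing -/

section AverageShadowing

variable {X : Type*} [MetricSpace X] {f : X → X}

theorem exists_dist_le [CompactSpace X] : ∃ D > 0, ∀ x y : X, dist x y ≤ D :=
  ⟨Metric.diam (Set.univ : Set X) + 1, by positivity, fun x y =>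
    (Metric.dist_le_diam_of_mem isCompact_univ.isBounded (Set.mem_univ x) (Set.mem_univ y)).trans
      (by linarith)⟩

theorem average_le {D : ℝ} {a : ℕ → ℝ} (ha : ∀ i, a i ≤ D) (hD : 0 ≤ D) (n : ℕ) :
    (1 / (n : ℝ)) * ∑ i ∈ Finset.range n, a i ≤ D := by
  rcases Nat.eq_zero_or_pos n with rfl | hn
  · simpa using hD
  · have : ∑ i ∈ Finset.range n, a i ≤ n * D := by
      simpa using Finset.sum_le_card_nsmul (Finset.range n) a D fun i _ => ha i
    rw [one_div, inv_mul_le_iff₀ (by positivity)]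
    exact this

theorem average_nonneg {a : ℕ → ℝ} (ha : ∀ i, 0 ≤ a i) (n : ℕ) :
    0 ≤ (1 / (n : ℝ)) * ∑ i ∈ Finset.range n, a i :=
  mul_nonneg (by positivity) (Finset.sum_nonneg fun i _ => ha i)

theorem ShadowedInAverage.eventually [CompactSpace X] {ε : ℝ} {x : ℕ → X} {y : X}
    (h : ShadowedInAverage f ε x y) :
    ∀ᶠ n : ℕ in atTop, (1 / (n : ℝ)) * ∑ i ∈ Finset.range n, dist (f^[i] y) (x i) < ε := by
  obtain ⟨D, hD, hDX⟩ := exists_dist_le (X := X)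
  exact eventually_lt_of_limsup_lt h
    (isBoundedUnder_of ⟨D, fun n => average_le (fun _ => hDX _ _) hD.le n⟩)

theorem shadowedInAverage_of_eventually {ε ε' : ℝ} {x : ℕ → X} {y : X} (hε : ε' < ε)
    (h : ∀ᶠ n : ℕ in atTop, (1 / (n : ℝ)) * ∑ i ∈ Finset.range n, dist (f^[i] y) (x i) ≤ ε') :
    ShadowedInAverage f ε x y :=
  (limsup_le_of_le (isCoboundedUnder_le_of_le atTop (x := 0)
    fun n => average_nonneg (fun _ => dist_nonneg) n) h).trans_lt hε

/-- Sequences that are `δ`-average-pseudo-orbits for all `δ > 0` are shadowed in average with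
any precision. -/
def WeakAverageShadowing (f : X → X) : Prop :=
  ∀ x : ℕ → X, (∀ δ : ℝ, 0 < δ → IsAveragePseudoOrbit f δ x) →
    ∀ ε : ℝ, 0 < ε → ∃ y : X, ShadowedInAverage f ε x y

theorem AverageShadowing.weakAverageShadowing (h : AverageShadowing f) :
    WeakAverageShadowing f := by
  intro x hx ε hε
  obtain ⟨δ, hδ, hδx⟩ := h ε hε
  exact hδx x (hx δ hδ)

theorem AsymptoticAverageShadowing.weakAverageShadowing (h : AsymptoticAverageShadowing f) :
    WeakAverageShadowing f := by
  intro x hx ε hε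
  obtain ⟨y, hy⟩ := h x (by
    refine Metric.tendsto_atTop.2 fun δ hδ => ?_
    obtain ⟨N, -, hN⟩ := hx δ hδ
    refine ⟨N, fun n hn => ?_⟩
    rw [Real.dist_0_eq_abs, abs_of_nonneg (average_nonneg (fun _ => dist_nonneg) n)]
    simpa using hN n 0 hn)
  refine ⟨y, shadowedInAverage_of_eventually (half_lt_self hε) ?_⟩
  filter_upwards [hy.eventually_lt_const (half_pos hε)] with n hn using hn.le

/-- A sequence which follows orbits except at the times `p * 2 ^ j - 1` is an average
pseudo-orbit. -/
theorem isAveragePseudoOrbit_of_two_pow [CompactSpace X] {p : ℕ} (hp : 0 < p) {x : ℕ → X}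
    (hx : ∀ i, (∀ j : ℕ, i + 1 ≠ p * 2 ^ j) → f (x i) = x (i + 1)) {δ : ℝ} (hδ : 0 < δ) :
    IsAveragePseudoOrbit f δ x := by
  obtain ⟨D, hD, hDX⟩ := exists_dist_le (X := X)
  -- A window of `n` times contains at most `Nat.log 2 (n + 1) + 1` exceptional times, wherever it
  -- starts, and each costs at most `D`.
  have hlim : Tendsto (fun n : ℕ => ((Nat.log 2 (n + 1) + 1 : ℕ) : ℝ) * D / n) atTop (𝓝 0) := by
    have h0 : Tendsto (fun n : ℕ => Real.log (n + 1 : ℕ) / (n + 1 : ℕ)) atTop (𝓝 0) :=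
      (Real.isLittleO_log_id_atTop.tendsto_div_nhds_zero.comp tendsto_natCast_atTop_atTop).comp
        (tendsto_add_atTop_nat 1)
    have h1 : Tendsto (fun n : ℕ => 2 * D / Real.log 2 *
        (Real.log (n + 1 : ℕ) / (n + 1 : ℕ)) + D / n) atTop (𝓝 0) := by
      simpa using (h0.const_mul (2 * D / Real.log 2)).add (tendsto_const_div_atTop_nhds_zero_nat D)
    refine tendsto_of_tendsto_of_tendsto_of_le_of_le' tendsto_const_nhds h1
      (Eventually.of_forall fun n => by positivity) ?_
    filter_upwards [eventually_ge_atTop 1] with n hn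
    have hlog : (Nat.log 2 (n + 1) : ℝ) ≤ Real.log (n + 1 : ℕ) / Real.log 2 :=
      Real.natLog_le_logb _ _
    have hn' : (1 : ℝ) ≤ n := by exact_mod_cast hn
    have hlog0 : 0 ≤ Real.log (n + 1 : ℕ) := Real.log_natCast_nonneg _
    have hl2 : 0 < Real.log 2 := Real.log_pos (by norm_num)
    have hdiv : (1 : ℝ) / n ≤ 2 / (n + 1 : ℕ) := by
      rw [div_le_div_iff₀ (by positivity) (by positivity)]
      push_cast
      linarith
    calc ((Nat.log 2 (n + 1) + 1 : ℕ) : ℝ) * D / n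
        = Nat.log 2 (n + 1) * D * (1 / n) + D / n := by push_cast; ring
      _ ≤ Real.log (n + 1 : ℕ) / Real.log 2 * D * (2 / (n + 1 : ℕ)) + D / n := by gcongr
      _ = _ := by ring
  obtain ⟨N, hN⟩ := eventually_atTop.1 (hlim.eventually_lt_const hδ)
  refine ⟨N + 1, by omega, fun n k hn => lt_of_le_of_lt ?_ (hN n (by omega))⟩
  rw [one_div, inv_mul_eq_div]
  gcongr
  classical
  set S := (Finset.range n).filter fun i => ∃ j : ℕ, i + k + 1 = p * 2 ^ j with hS
  have h1 : ∑ i ∈ Finset.range n, dist (f (x (i + k))) (x (i + k + 1)) ≤ S.card * D := by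
    rw [← nsmul_eq_mul, ← Finset.sum_const, hS, Finset.sum_filter]
    refine Finset.sum_le_sum fun i _ => ?_
    split_ifs with h
    · exact hDX _ _
    · push Not at h
      simp [hx (i + k) h]
  refine h1.trans ?_
  gcongr
  rcases S.eq_empty_or_nonempty with h0 | h0
  · simp [h0]
  -- Measured from the first exceptional time `p * 2 ^ j₀` in the window, a later one is larger by a
  -- factor `2 ^ l`; since both lie in the window, `2 ^ l ≤ n + 1`.
  obtain ⟨i₀, hi₀, hmin⟩ := S.exists_min_image id h0
  obtain ⟨hi₀n, j₀, hj₀⟩ := Finset.mem_filter.1 hi₀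
  have hsub : S ⊆ (Finset.range (Nat.log 2 (n + 1) + 1)).image
      fun l => p * 2 ^ (j₀ + l) - (k + 1) := by
    intro i hi
    obtain ⟨hin, j, hj⟩ := Finset.mem_filter.1 hi
    have hle : i₀ ≤ i := hmin i hi
    have hjj : j₀ ≤ j := by
      by_contra hlt
      have : p * 2 ^ j < p * 2 ^ j₀ :=
        Nat.mul_lt_mul_of_pos_left (Nat.pow_lt_pow_right (by norm_num) (by omega)) hp
      omega
    obtain ⟨l, rfl⟩ := Nat.exists_eq_add_of_le hjj
    refine Finset.mem_image.2 ⟨l, ?_, by omega⟩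
    rw [Finset.mem_range, Nat.lt_succ_iff]
    refine Nat.le_log_of_pow_le (by norm_num) ?_
    rw [Finset.mem_range] at hin hi₀n
    have h2 : p * 2 ^ (j₀ + l) = p * 2 ^ j₀ * 2 ^ l := by ring
    have h3 : 1 ≤ p * 2 ^ j₀ := Nat.mul_pos hp (by positivity)
    have h4 : 1 ≤ 2 ^ l := Nat.one_le_two_pow
    nlinarith
  exact (Finset.card_le_card hsub).trans (Finset.card_image_le.trans (by simp))

/-- On the blocks `[p * 2 ^ j, p * 2 ^ (j + 1))` the sequence `w` alternately follows an orbit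
starting at `x` and one reaching `y` when the block ends. The shadowing orbit comes close to `w` in
every late block, so it leads from an even block to the next odd one. The resulting chain from `x`
to `y` spans both blocks, and its length `p * (3 * 2 ^ (2 * M))` is a multiple of `p`. -/
theorem WeakAverageShadowing.chainMixing [CompactSpace X] (hf : Continuous f)
    (hs : Function.Surjective f) (h : WeakAverageShadowing f) : ChainMixing f := by
  refine chainMixing_of_mul fun δ hδ x y p hp => ?_
  obtain ⟨η, hη, hc⟩ := exists_chain_of_orbit hf hδ
  choose b hb using fun j : ℕ => hs.iterate (p * 2 ^ j) y
  let a : ℕ → X := fun j => if Even j then x else b j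
  let w : ℕ → X := fun i => if i < p then f^[i] x else
    f^[i - p * 2 ^ Nat.log 2 (i / p)] (a (Nat.log 2 (i / p)))
  have hblock : ∀ j i, p * 2 ^ j ≤ i → i < p * 2 ^ (j + 1) → Nat.log 2 (i / p) = j := by
    intro j i hi hi'
    rw [Nat.log_eq_iff (Or.inr ⟨by norm_num, ?_⟩)]
    · exact ⟨(Nat.le_div_iff_mul_le hp).2 (by rwa [mul_comm]), (Nat.div_lt_iff_lt_mul hp).2
        (by rwa [mul_comm])⟩
    · have h1 : 1 ≤ i / p := (Nat.le_div_iff_mul_le hp).2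
        (by linarith [Nat.mul_le_mul_left p (Nat.one_le_two_pow (n := j))])
      omega
  have hwb : ∀ j i, p * 2 ^ j ≤ i → i < p * 2 ^ (j + 1) → w i = f^[i - p * 2 ^ j] (a j) := by
    intro j i hi hi'
    have h1 : ¬ i < p := by
      linarith [Nat.mul_le_mul_left p (Nat.one_le_two_pow (n := j))]
    simp only [w, hblock j i hi hi', h1, if_false]
  have hw : ∀ i, (∀ j : ℕ, i + 1 ≠ p * 2 ^ j) → f (w i) = w (i + 1) := by
    intro i hi
    rcases lt_or_ge i p with h1 | h1
    · have h2 : i + 1 < p := lt_of_le_of_ne h1 (by simpa using hi 0)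
      simp only [w, h1, h2, if_true, Function.iterate_succ_apply']
    · have h2 : i / p ≠ 0 := (Nat.div_pos h1 hp).ne'
      obtain ⟨h3, h4⟩ := (Nat.log_eq_iff (b := 2) (Or.inr ⟨by norm_num, h2⟩)).1 rfl
      rw [Nat.le_div_iff_mul_le hp, mul_comm] at h3
      rw [Nat.div_lt_iff_lt_mul hp, mul_comm] at h4
      rw [hwb _ i h3 h4, hwb _ (i + 1) (by omega) (lt_of_le_of_ne h4 (hi _)),
        ← Function.iterate_succ_apply' f, Nat.succ_eq_add_one, Nat.sub_add_comm h3]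
  obtain ⟨z, hz⟩ := h w (fun δ hδ => isAveragePseudoOrbit_of_two_pow hp hw hδ) (η / 2)
    (by positivity)
  obtain ⟨M, hM⟩ := eventually_atTop.1 hz.eventually
  -- A block is half of all the time up to its end, so distances at least `η` throughout it would
  -- give an average of at least `η / 2`.
  have hgood : ∀ j, M ≤ j → ∃ i, p * 2 ^ j ≤ i ∧ i < p * 2 ^ (j + 1) ∧
      dist (f^[i] z) (w i) < η := by
    intro j hj
    by_contra! hbad
    have hp2 : 0 < p * 2 ^ j := by positivity
    have hlt : j < p * 2 ^ (j + 1) := by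
      nlinarith [(Nat.lt_two_pow_self (n := j)), pow_succ 2 j, Nat.one_le_two_pow (n := j)]
    have h1 := hM (p * 2 ^ (j + 1)) (by omega)
    rw [one_div, inv_mul_lt_iff₀ (by positivity)] at h1
    have h2 : ((p * 2 ^ j : ℕ) : ℝ) * η ≤
        ∑ i ∈ Finset.Ico (p * 2 ^ j) (p * 2 ^ (j + 1)), dist (f^[i] z) (w i) := by
      have := Finset.card_nsmul_le_sum (Finset.Ico (p * 2 ^ j) (p * 2 ^ (j + 1)))
        (fun i => dist (f^[i] z) (w i)) η fun i hi =>
          hbad i (Finset.mem_Ico.1 hi).1 (Finset.mem_Ico.1 hi).2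
      rwa [Nat.card_Ico, nsmul_eq_mul, show p * 2 ^ (j + 1) - p * 2 ^ j = p * 2 ^ j by
        rw [pow_succ, ← mul_assoc]; omega] at this
    have h3 := h2.trans (Finset.sum_le_sum_of_subset_of_nonneg
      (t := Finset.range (p * 2 ^ (j + 1)))
      (fun i hi => Finset.mem_range.2 (Finset.mem_Ico.1 hi).2) fun _ _ _ => dist_nonneg)
    push_cast [pow_succ] at h1 h3
    linarith
  obtain ⟨i, hi, hi', hiz⟩ := hgood (2 * M) (by omega)
  obtain ⟨l, hl, hl', hlz⟩ := hgood (2 * M + 1) (by omega)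
  rw [hwb _ _ hi hi', dist_comm] at hiz
  rw [hwb _ _ hl hl', dist_comm] at hlz
  simp only [a, even_two_mul, if_true, Nat.not_even_bit1, if_false] at hiz hlz
  have hc' := hc _ _ (f^[i] z) (l - i) (by omega) hiz (by
    rwa [← Function.iterate_add_apply, show l - i + i = l by omega])
  have hfin := ((chain_iterate (f := f) hδ x _).trans hc').trans
    (chain_iterate hδ _ (p * 2 ^ (2 * M + 1 + 1) - l))
  have e : p * 2 ^ (2 * M + 1 + 1) = 2 * (p * 2 ^ (2 * M + 1)) := by ring
  have e' : p * 2 ^ (2 * M + 1) = 2 * (p * 2 ^ (2 * M)) := by ring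
  rw [← Function.iterate_add_apply, show p * 2 ^ (2 * M + 1 + 1) - l + (l - p * 2 ^ (2 * M + 1)) =
    p * 2 ^ (2 * M + 1) by omega, hb] at hfin
  refine ⟨3 * 2 ^ (2 * M), by positivity, ?_⟩
  convert hfin using 1
  have e'' : p * (3 * 2 ^ (2 * M)) = 3 * (p * 2 ^ (2 * M)) := by ring
  omega

end AverageShadowing

/-! ### Specification and periodic specification -/

section Specification

variable {X : Type*} [MetricSpace X] {f : X → X}

theorem IsSpaced.mono {N s : ℕ} {j k : ℕ → ℕ} (h : IsSpaced N s j k) {m m' : ℕ} (hm : m ≤ m')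
    (hs : m' ≤ s) : j m ≤ j m' ∧ k m ≤ k m' := by
  induction m', hm using Nat.le_induction with
  | base => exact ⟨le_rfl, le_rfl⟩
  | succ q hq ih =>
    have h₁ := ih (by omega)
    have h₂ := h.1 q (by omega)
    have h₃ := h.1 (q + 1) hs
    have h₄ := h.2 q (by omega)
    omega

/-- A pseudo-orbit that follows prescribed orbits on the given time windows. -/
theorem exists_isPseudoOrbit_of_isSpaced {δ : ℝ} (hδ : 0 < δ) {N : ℕ}
    (hN : ∀ n ≥ N, ∀ x y : X, Chain f δ x y n) (s : ℕ) (y : ℕ → X) (j k : ℕ → ℕ)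
    (h : IsSpaced N s j k) :
    ∃ w : ℕ → X, IsPseudoOrbit f δ w ∧ (∀ m ≤ s, ∀ i, j m ≤ i → i ≤ k m → w i = f^[i] (y m)) ∧
      ∀ i, j s ≤ i → w i = f^[i] (y s) := by
  -- The last clause strengthens the induction: `w` stays on the orbit of `y s` beyond `j s`, so it
  -- can be left at time `k s` for a chain to the next window.
  induction s with
  | zero =>
    refine ⟨fun i => f^[i] (y 0), fun i => ?_, fun m hm i _ _ => ?_, fun i _ => rfl⟩
    · simpa [Function.iterate_succ_apply'] using hδ
    · rw [Nat.le_zero.1 hm]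
  | succ s ih =>
    obtain ⟨w, hw, hwm, hws⟩ := ih ⟨fun m hm => h.1 m (by omega), fun m hm => h.2 m (by omega)⟩
    have hgap := h.2 s (by omega)
    have hjk := h.1 s (by omega)
    obtain ⟨u, hu0, hun, hu⟩ := hN (j (s + 1) - k s) (by omega) (f^[k s] (y s))
      (f^[j (s + 1)] (y (s + 1)))
    have hk : ∀ m ≤ s, k m ≤ k s := fun m hm => (h.mono hm (by omega)).2
    let v : ℕ → X := fun i => if i ≤ k s then w i else
      if i < j (s + 1) then u (i - k s) else f^[i] (y (s + 1))
    have hv1 : ∀ i, i ≤ k s → v i = w i := fun i hi => by simp [v, hi]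
    have hv2 : ∀ i, k s ≤ i → i ≤ j (s + 1) → v i = u (i - k s) := by
      intro i hi hi'
      rcases hi.eq_or_lt with rfl | hi
      · simp [v, hu0, hws _ hjk]
      · rcases hi'.eq_or_lt with rfl | hi'
        · simp [v, hun, hi.not_ge]
        · simp [v, hi.not_ge, hi']
    have hv3 : ∀ i, j (s + 1) ≤ i → v i = f^[i] (y (s + 1)) := by
      intro i hi
      rcases (show k s ≤ j (s + 1) by omega).eq_or_lt with he | hlt
      · rcases hi.eq_or_lt with rfl | hi
        · rw [hv2 _ he.le le_rfl, hun]
        · simp [v, show ¬ i ≤ k s by omega, hi.not_gt]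
      · simp [v, show ¬ i ≤ k s by omega, hi.not_gt]
    refine ⟨v, fun i => ?_, fun m hm i hi hi' => ?_, hv3⟩
    · rcases lt_or_ge i (k s) with h1 | h1
      · rw [hv1 i h1.le, hv1 _ h1]
        exact hw i
      · rcases lt_or_ge i (j (s + 1)) with h2 | h2
        · rw [hv2 i h1 h2.le, hv2 (i + 1) (by omega) h2, Nat.sub_add_comm h1]
          exact hu _ (by omega)
        · rw [hv3 i h2, hv3 _ (by omega), Function.iterate_succ_apply', dist_self]
          exact hδ
    · rcases hm.eq_or_lt with rfl | hm
      · exact hv3 i hi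
      · rw [hv1 i (hi'.trans (hk m (by omega)))]
        exact hwm m (by omega) i hi hi'

theorem Mixing.specification [CompactSpace X] (hf : Continuous f) (hsh : Shadowing f)
    (h : Mixing f) : Specification f := by
  intro ε hε
  obtain ⟨δ, hδ, hδs⟩ := hsh ε hε
  obtain ⟨N, hN, hc⟩ := h.exists_forall_chain hf hδ
  refine ⟨N, hN, fun s y j k hjk => ?_⟩
  obtain ⟨w, hw, hwm, -⟩ := exists_isPseudoOrbit_of_isSpaced hδ hc s y j k hjk
  obtain ⟨z, hz⟩ := hδs w hw
  exact ⟨z, fun m hm i hi hi' => hwm m hm i hi hi' ▸ hz i⟩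

theorem Specification.mixing (hs : Function.Surjective f) (h : Specification f) : Mixing f := by
  rintro U V hU ⟨x, hx⟩ hV ⟨y, hy⟩
  obtain ⟨ε₁, hε₁, hxU⟩ := Metric.isOpen_iff.1 hU x hx
  obtain ⟨ε₂, hε₂, hyV⟩ := Metric.isOpen_iff.1 hV y hy
  obtain ⟨N, hN, hspec⟩ := h (min ε₁ ε₂) (by positivity)
  refine ⟨N, hN, fun n hn => ?_⟩
  obtain ⟨y', rfl⟩ := hs.iterate n y
  obtain ⟨z, hz⟩ := hspec 1 (fun m => if m = 0 then x else y') (fun m => m * n) (fun m => m * n)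
    ⟨fun _ _ => le_rfl, fun m _ => by dsimp only; rw [Nat.succ_mul]; omega⟩
  have h0 := hz 0 (by omega) 0 (by simp) (by simp)
  have h1 := hz 1 (by omega) n (by simp) (by simp)
  simp only [Function.iterate_zero, id, if_true, one_ne_zero, if_false] at h0 h1
  exact ⟨f^[n] z, ⟨z, hxU (h0.trans_le (min_le_left _ _)), rfl⟩,
    hyV (h1.trans_le (min_le_right _ _))⟩

theorem PeriodicSpecification.specification (h : PeriodicSpecification f) : Specification f := by
  intro ε hε
  obtain ⟨N, hN, hspec⟩ := h ε hε
  refine ⟨N, hN, fun s y j k hjk => ?_⟩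
  obtain ⟨x, hx, -⟩ := hspec s y j k hjk (N + k s) (by omega)
  exact ⟨x, hx⟩

/-- Tracing a single time by periodic points shows that they are dense; they lie in the range, which
is closed. -/
theorem PeriodicSpecification.surjective [CompactSpace X] (hf : Continuous f)
    (h : PeriodicSpecification f) : Function.Surjective f := by
  have hc : IsClosed (Set.range f) := (isCompact_range hf).isClosed
  rw [← Set.range_eq_univ, ← hc.closure_eq]
  refine Set.eq_univ_of_forall fun y => Metric.mem_closure_iff.2 fun ε hε => ?_
  obtain ⟨N, hN, hspec⟩ := h ε hε
  obtain ⟨x, hx, hp⟩ := hspec 0 (fun _ => y) (fun _ => 0) (fun _ => 0)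
    ⟨fun _ _ => le_rfl, fun m hm => by omega⟩ N (by omega)
  refine ⟨x, ⟨f^[N - 1] x, ?_⟩, ?_⟩
  · rw [← Function.iterate_succ_apply' f, show (N - 1).succ = N by omega, hp]
  · have := hx 0 le_rfl 0 le_rfl le_rfl
    rwa [dist_comm] at this

/-- In a compact system a point whose forward orbit is close to a two-sided periodic sequence
gives rise to a two-sided orbit close to that sequence. -/
theorem exists_orbit_int_dist_le [CompactSpace X] (hf : Continuous f) {p : ℕ} (hp : 0 < p)
    {ε : ℝ} {w : ℤ → X} (hw : ∀ n, w (n + p) = w n) {z : X}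
    (hz : ∀ n : ℕ, dist (f^[n] z) (w n) < ε) :
    ∃ u : ℤ → X, (∀ n, f (u n) = u (n + 1)) ∧ ∀ n, dist (u n) (w n) ≤ ε := by
  let 𝒰 : Ultrafilter ℕ := hyperfilter ℕ
  -- The orbit of `z` is viewed from time `k * p`, and the ultrafilter takes the limit in `k` at all
  -- `n` simultaneously. The truncation by `toNat` occurs only for small `k`.
  let v : ℤ → ℕ → X := fun n k => f^[((k * p : ℕ) + n).toNat] z
  have hlim : ∀ n, ∃ a, Tendsto (v n) 𝒰 (𝓝 a) := fun n => by
    obtain ⟨a, -, ha⟩ := isCompact_univ.ultrafilter_le_nhds (𝒰.map (v n)) (by simp)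
    exact ⟨a, ha⟩
  choose u hu using hlim
  have hev : ∀ n : ℤ, ∀ᶠ k : ℕ in (𝒰 : Filter ℕ), 0 ≤ ((k * p : ℕ) : ℤ) + n := by
    intro n
    refine (Nat.hyperfilter_le_atTop : (𝒰 : Filter ℕ) ≤ atTop) ?_
    filter_upwards [eventually_ge_atTop n.natAbs] with k hk
    have : k ≤ k * p := Nat.le_mul_of_pos_right k hp
    omega
  refine ⟨u, fun n => ?_, fun n => ?_⟩
  · refine tendsto_nhds_unique ((hf.tendsto _).comp (hu n)) ((hu (n + 1)).congr' ?_)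
    filter_upwards [hev n] with k hk
    simp only [v, Function.comp]
    rw [← Function.iterate_succ_apply' f]
    congr 2
    omega
  · refine le_of_tendsto ((hu n).dist tendsto_const_nhds) ?_
    filter_upwards [hev n] with k hk
    have h1 := hz ((k * p : ℕ) + n).toNat
    have h2 : w (((k * p : ℕ) + n).toNat : ℕ) = w n := by
      rw [Int.toNat_of_nonneg hk]
      clear hk h1
      induction k with
      | zero => simp
      | succ k ih =>
        rw [← ih, ← hw ((k * p : ℕ) + n)]
        congr 1
        push_cast
        ring
    rw [h2] at h1
    exact h1.le

/-- A pseudo-orbit through the windows is closed up after `p` steps and repeated periodically. A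
two-sided orbit following it within `β / 2` is within `β` of its own shift by `p`, so c-expansivity
makes it periodic. -/
theorem Mixing.periodicSpecification [CompactSpace X] (hf : Continuous f) (hsh : Shadowing f)
    (he : CExpansive f) (h : Mixing f) : PeriodicSpecification f := by
  intro ε hε
  obtain ⟨β, hβ, hexp⟩ := he
  obtain ⟨δ, hδ, hδs⟩ := hsh (min (ε / 2) (β / 2)) (by positivity)
  obtain ⟨N, hN, hc⟩ := h.exists_forall_chain hf hδ
  refine ⟨N, hN, fun s y j k hjk p hp => ?_⟩
  have hmono : ∀ m ≤ s, j 0 ≤ j m ∧ k m ≤ k s := fun m hm =>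
    ⟨(hjk.mono (Nat.zero_le m) hm).1, (hjk.mono hm le_rfl).2⟩
  have hjks := hjk.1 s le_rfl
  have hp0 : 0 < p := by have := (hmono s le_rfl).1; omega
  -- An extra window at time `j 0 + p` brings the pseudo-orbit back to its value at time `j 0`.
  obtain ⟨y', hy'⟩ := (h.surjective hf).iterate (j 0 + p) (f^[j 0] (y 0))
  obtain ⟨w, hw, hwm, -⟩ := exists_isPseudoOrbit_of_isSpaced hδ hc (s + 1)
    (fun m => if m ≤ s then y m else y') (fun m => if m ≤ s then j m else j 0 + p)
    (fun m => if m ≤ s then k m else j 0 + p) (by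
      refine ⟨fun m hm => ?_, fun m hm => ?_⟩
      · dsimp only
        split_ifs with h1
        · exact hjk.1 m h1
        · exact le_rfl
      · rcases (Nat.lt_succ_iff.1 hm).eq_or_lt with rfl | h1
        · simp; omega
        · have := hjk.2 m h1
          simpa [h1.le, Nat.succ_le_of_lt h1] using this)
  have hwper : w (j 0 + p) = w (j 0) := by
    have h1 := hwm (s + 1) le_rfl (j 0 + p) (by simp) (by simp)
    have h2 := hwm 0 (by omega) (j 0) (by simp) (by simpa using hjk.1 0 (by omega))
    simp only [Nat.not_succ_le_self, if_false, Nat.zero_le, if_true] at h1 h2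
    rw [h1, h2, hy']
  have hwm' : ∀ m ≤ s, ∀ i, j m ≤ i → i ≤ k m → w i = f^[i] (y m) := by
    intro m hm i hi hi'
    have := hwm m (by omega) i (by simpa [hm] using hi) (by simpa [hm] using hi')
    simpa [hm] using this
  let W : ℤ → X := fun n => w (j 0 + ((n - j 0) % p).toNat)
  have hpZ : (0 : ℤ) < p := by exact_mod_cast hp0
  have hWper : ∀ n, W (n + p) = W n := by
    intro n
    simp only [W, show n + p - j 0 = n - j 0 + p by ring, Int.add_emod_right]
  have hWw : ∀ i, j 0 ≤ i → i < j 0 + p → W i = w i := by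
    intro i hi hi'
    have : ((i : ℤ) - j 0) % p = i - j 0 := Int.emod_eq_of_lt (by omega) (by omega)
    simp only [W, this]
    congr 1
    omega
  have hWp : ∀ n, dist (f (W n)) (W (n + 1)) < δ := by
    intro n
    have h1 : 0 ≤ (n - j 0) % p := Int.emod_nonneg _ hpZ.ne'
    have h2 : (n - j 0) % p < p := Int.emod_lt_of_pos _ hpZ
    have h3 : (n + 1 - j 0) % p = ((n - j 0) % p + 1) % p := by
      rw [Int.emod_add_emod]; congr 1; ring
    have h4 : W (n + 1) = w (j 0 + ((n - j 0) % p).toNat + 1) := by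
      simp only [W, h3]
      rcases (show (n - j 0) % p + 1 ≤ p by omega).eq_or_lt with h5 | h5
      · rw [h5, Int.emod_self, Int.toNat_zero, add_zero, ← hwper]
        congr 1
        omega
      · rw [Int.emod_eq_of_lt (by omega) h5]
        congr 1
        omega
    rw [h4]
    exact hw _
  obtain ⟨z, hz⟩ := hδs (fun n => W n) (fun n => by simpa using hWp n)
  obtain ⟨u, hu, huW⟩ := exists_orbit_int_dist_le hf hp0 hWper hz
  have huper : (fun n => u (n + p)) = u := by
    refine hexp _ _ (fun n => ?_) hu fun n => ?_
    · rw [hu]; congr 1; ring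
    · have h1 := huW (n + p)
      rw [hWper] at h1
      have h2 := huW n
      have h3 := min_le_right (ε / 2) (β / 2)
      linarith [dist_triangle_right (u (n + p)) (u n) (W n)]
  have hit : ∀ n : ℕ, f^[n] (u 0) = u n := by
    intro n
    induction n with
    | zero => rfl
    | succ n ih => rw [Function.iterate_succ_apply', ih, hu]; rfl
  refine ⟨u 0, fun m hm i hi hi' => ?_, ?_⟩
  · have h1 := hmono m hm
    rw [hit, ← hwm' m hm i hi hi', ← hWw i (by omega) (by omega)]
    have h3 := min_le_left (ε / 2) (β / 2)
    linarith [huW i]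
  · rw [hit]
    simpa using congrFun huper 0

end Specification

/-! ### Gluing orbit segments of varying precision -/

section Gluing

variable {X : Type*} [MetricSpace X] {f : X → X}

/-- A pseudo-orbit segment with prescribed end points that follows the orbit of `x` except near
its ends. -/
theorem exists_pseudoOrbit_segment {δ : ℝ} (hδ : 0 < δ) {N : ℕ}
    (hN : ∀ n ≥ N, ∀ x y : X, Chain f δ x y n) (a b x : X) {n : ℕ} (hn : 2 * N ≤ n) :
    ∃ u : ℕ → X, u 0 = a ∧ u n = b ∧ (∀ t, N ≤ t → t + N ≤ n → u t = f^[t] x) ∧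
      ∀ t < n, dist (f (u t)) (u (t + 1)) < δ := by
  obtain ⟨v, hv0, hvN, hv⟩ := hN N le_rfl a (f^[N] x)
  obtain ⟨v', hv0', hvN', hv'⟩ := hN N le_rfl (f^[n - N] x) b
  let u : ℕ → X := fun t => if t < N then v t else if t + N ≤ n then f^[t] x else v' (t - (n - N))
  have hu₁ : ∀ t ≤ N, u t = v t := by
    intro t ht
    rcases ht.eq_or_lt with rfl | ht
    · simp [u, hvN, show t + t ≤ n by omega]
    · simp [u, ht]
  have hu₂ : ∀ t, N ≤ t → t + N ≤ n → u t = f^[t] x := fun t ht ht' => by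
    simp [u, ht.not_gt, ht']
  have hu₃ : ∀ t, n ≤ t + N → N ≤ t → u t = v' (t - (n - N)) := by
    intro t ht ht'
    rcases ht.eq_or_lt with rfl | ht
    · simp [u, ht'.not_gt, hv0']
    · simp [u, ht'.not_gt, ht.not_ge]
  refine ⟨u, by rw [hu₁ 0 (Nat.zero_le _), hv0], ?_, hu₂, fun t ht => ?_⟩
  · rw [hu₃ n (by omega) (by omega), show n - (n - N) = N by omega, hvN']
  · rcases lt_or_ge t N with h1 | h1
    · rw [hu₁ t h1.le, hu₁ (t + 1) h1]
      exact hv t h1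
    · rcases lt_or_ge (t + N) n with h2 | h2
      · rw [hu₂ t h1 h2.le, hu₂ (t + 1) (by omega) (by omega), Function.iterate_succ_apply',
          dist_self]
        exact hδ
      · rw [hu₃ t h2 h1, hu₃ (t + 1) (by omega) (by omega),
          show t + 1 - (n - N) = t - (n - N) + 1 by omega]
        exact hv' _ (by omega)

/-- Shadowing on the maximal intervals of a set of times. -/
theorem exists_orbit_on {ε δ : ℝ} (hδ : 0 < δ)
    (h : ∀ x : ℕ → X, IsPseudoOrbit f δ x → ∃ z : X, ∀ i : ℕ, dist (f^[i] z) (x i) < ε)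
    (A : ℕ → Prop) (w : ℕ → X) (hw : ∀ t, A t → A (t + 1) → dist (f (w t)) (w (t + 1)) < δ) :
    ∃ w' : ℕ → X, (∀ t, ¬ A t → w' t = w t) ∧
      (∀ t, A t → A (t + 1) → f (w' t) = w' (t + 1)) ∧ ∀ t, A t → dist (w' t) (w t) < ε := by
  classical
  have hz : ∀ a : ℕ, ∃ z : X, ∀ i, (∀ t, a ≤ t → t ≤ a + i → A t) →
      dist (f^[i] z) (w (a + i)) < ε := by
    intro a
    -- The sequence follows `w` from time `a` while `A` persists, then continues as a true orbit.
    let v : ℕ → X := fun i => Nat.rec (w a)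
      (fun i y => if ∀ t, a ≤ t → t ≤ a + (i + 1) → A t then w (a + (i + 1)) else f y) i
    have hv : ∀ i, (∀ t, a ≤ t → t ≤ a + i → A t) → v i = w (a + i) := by
      rintro (_ | i) hi
      · rfl
      · exact if_pos hi
    obtain ⟨z, hz⟩ := h v (fun i => by
      by_cases hi : ∀ t, a ≤ t → t ≤ a + (i + 1) → A t
      · rw [hv _ hi, hv i fun t ht ht' => hi t ht (by omega)]
        exact hw _ (hi _ (by omega) (by omega)) (hi _ (by omega) (by omega))
      · have : v (i + 1) = f (v i) := if_neg hi
        rwa [this, dist_self])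
    exact ⟨z, fun i hi => hv i hi ▸ hz i⟩
  choose z hz using hz
  -- When `A t` holds, `start t` is the first time of the maximal interval of `A` containing `t`.
  let start : ℕ → ℕ := fun t => Nat.rec 0 (fun t s => if A t then s else t + 1) t
  have hstart : ∀ t, start t ≤ t ∧ ∀ s, start t ≤ s → s < t → A s := by
    intro t
    induction t with
    | zero => exact ⟨le_rfl, fun s _ hs => by omega⟩
    | succ t ih =>
      by_cases ht : A t
      · have : start (t + 1) = start t := if_pos ht
        rw [this]
        refine ⟨by omega, fun s hs hs' => ?_⟩
        rcases (Nat.lt_succ_iff.1 hs').eq_or_lt with rfl | h1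
        · exact ht
        · exact ih.2 s hs h1
      · have : start (t + 1) = t + 1 := if_neg ht
        rw [this]
        exact ⟨le_rfl, fun s hs hs' => by omega⟩
  refine ⟨fun t => if A t then f^[t - start t] (z (start t)) else w t, fun t ht => if_neg ht,
    fun t ht ht' => ?_, fun t ht => ?_⟩
  · have : start (t + 1) = start t := if_pos ht
    simp only [if_pos ht, if_pos ht', this]
    rw [← Function.iterate_succ_apply' f,
      Nat.sub_add_comm (hstart t).1]
  · obtain ⟨h1, h2⟩ := hstart t
    have := hz (start t) (t - start t) (fun s hs hs' => by
      rcases (show s ≤ t by omega).eq_or_lt with rfl | h3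
      · exact ht
      · exact h2 s hs h3)
    rw [Nat.add_sub_cancel' h1] at this
    simpa only [if_pos ht] using this

theorem StrictMono.exists_index {l : ℕ → ℕ} (hl : StrictMono l) (h0 : l 0 = 0) :
    ∃ seg : ℕ → ℕ, (∀ t, l (seg t) ≤ t ∧ t < l (seg t + 1)) ∧
      ∀ t j, l j ≤ t → t < l (j + 1) → seg t = j := by
  have hex : ∀ t, ∃ j, l j ≤ t ∧ t < l (j + 1) := by
    intro t
    have hlt : ∃ j, t < l j := ⟨t + 1, hl.le_apply⟩
    classical
    have h1 : Nat.find hlt ≠ 0 := fun h => by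
      have := Nat.find_spec hlt
      rw [h, h0] at this
      omega
    refine ⟨Nat.find hlt - 1, not_lt.1 (Nat.find_min hlt (by omega)), ?_⟩
    rw [Nat.sub_add_cancel (by omega)]
    exact Nat.find_spec hlt
  choose seg hseg using hex
  refine ⟨seg, hseg, fun t j hj hj' => ?_⟩
  have h1 := hl.lt_iff_lt.1 ((hseg t).1.trans_lt hj')
  have h2 := hl.lt_iff_lt.1 (hj.trans_lt (hseg t).2)
  omega

/-- Orbit segments of levels below `K` are glued together with precision depending on the level;
the other segments are left alone. -/
theorem exists_glued_below {δ : ℕ → ℝ} (hδ : ∀ k, 0 < δ k)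
    (hsh : ∀ (k : ℕ) (x : ℕ → X), IsPseudoOrbit f (δ k) x →
      ∃ z : X, ∀ i : ℕ, dist (f^[i] z) (x i) < (1 / 2) ^ k)
    {N : ℕ → ℕ} (hN0 : ∀ k, 0 < N k)
    (hN : ∀ k, ∀ n ≥ N k, ∀ x y : X, Chain f (δ k) x y n)
    (lev l : ℕ → ℕ) (hl : ∀ j, l j + 2 * N (lev j) ≤ l (j + 1)) (x : ℕ → X)
    {seg : ℕ → ℕ} (hseg : ∀ t, l (seg t) ≤ t ∧ t < l (seg t + 1))
    (hseg' : ∀ t j, l j ≤ t → t < l (j + 1) → seg t = j) (K : ℕ) :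
    ∃ w : ℕ → X,
      (∀ j, lev j < K → ∀ t, N (lev j) ≤ t → l j + t + N (lev j) ≤ l (j + 1) →
        dist (w (l j + t)) (f^[t] (x j)) ≤ 2 * (1 / 2) ^ lev j - 2 * (1 / 2) ^ K) ∧
      (∀ j, K ≤ lev j → ∀ t, l j + t < l (j + 1) → w (l j + t) = f^[t] (x j)) ∧
      ∀ t, lev (seg t) < K → lev (seg (t + 1)) < K → f (w t) = w (t + 1) := by
  have hlt : ∀ j, l j < l (j + 1) := fun j => by
    have := hl j
    have := hN0 (lev j)
    omega
  -- Stage `K` fits the segments of level `K` between their neighbours by `δ K`-chains, then shadows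
  -- on all levels up to `K` with error `(1 / 2) ^ K`. A segment of level `k < K` has by then
  -- collected the sum of `(1 / 2) ^ i` over `k ≤ i < K`, which is the stated bound.
  induction K with
  | zero =>
    refine ⟨fun t => f^[t - l (seg t)] (x (seg t)), fun j hj => by omega, fun j _ t ht => ?_,
      fun t ht => by omega⟩
    simp [hseg' (l j + t) j (by omega) ht]
  | succ K ih =>
    obtain ⟨w, hw₁, hw₂, hw₃⟩ := ih
    -- A new segment starts exactly where a preceding coarser segment leads, and ends at the current
    -- first point of its successor. If `l j = 0`, then `l j - 1` still lies in segment `j`, of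
    -- level `K`, so the second branch applies.
    choose u hu0 hun hux hu using fun j : {j // lev j = K} =>
      exists_pseudoOrbit_segment (hδ K) (hN K)
        (if lev (seg (l j.1 - 1)) < K then f (w (l j.1 - 1)) else w (l j.1)) (w (l (j.1 + 1)))
        (x j.1) (n := l (j.1 + 1) - l j.1) (by have := hl j.1; rw [j.2] at this; omega)
    let v : ℕ → X := fun t =>
      if h : lev (seg t) = K then u ⟨seg t, h⟩ (t - l (seg t)) else w t
    have hvK : ∀ j (hj : lev j = K) t, l j + t < l (j + 1) → v (l j + t) = u ⟨j, hj⟩ t := by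
      intro j hj t ht
      have h1 := hseg' (l j + t) j (by omega) ht
      have h2 : ∀ i, i = j → (if h : lev i = K then u ⟨i, h⟩ (l j + t - l i) else w (l j + t)) =
          u ⟨j, hj⟩ t := by
        rintro _ rfl
        rw [dif_pos hj, Nat.add_sub_cancel_left]
      exact h2 _ h1
    have hvw : ∀ t, lev (seg t) ≠ K → v t = w t := fun t ht => dif_neg ht
    have hv : ∀ t, lev (seg t) < K + 1 → lev (seg (t + 1)) < K + 1 →
        dist (f (v t)) (v (t + 1)) < δ K := by
      intro t ht ht'
      obtain ⟨h1, h2⟩ := hseg t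
      obtain ⟨j, hj⟩ : ∃ j, seg t = j := ⟨_, rfl⟩
      rw [hj] at h1 h2 ht
      obtain ⟨s, rfl⟩ := Nat.exists_eq_add_of_le h1
      rcases (Nat.lt_iff_add_one_le.1 h2).lt_or_eq with h3 | h3
      · have h4 : seg (l j + s + 1) = j := hseg' _ _ (by omega) h3
        by_cases hjK : lev j = K
        · rw [hvK j hjK s h2, add_assoc, hvK j hjK (s + 1) h3]
          exact hu _ s (by simp only; omega)
        · rw [hvw _ (by rwa [hj]), hvw _ (by rwa [h4]), hw₃, dist_self]
          · exact hδ K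
          · rw [hj]; omega
          · rw [h4]; omega
      · have h4 : seg (l j + s + 1) = j + 1 := hseg' _ _ h3.ge (by rw [h3]; exact hlt _)
        rw [h4] at ht'
        have hfirst : ∀ hK : lev (j + 1) = K, v (l j + s + 1) =
            if lev j < K then f (w (l j + s)) else w (l (j + 1)) := by
          intro hK
          have h5 := hvK (j + 1) hK 0 (hlt _)
          rw [add_zero, hu0] at h5
          rw [h3, h5]
          simp only [show l (j + 1) - 1 = l j + s by omega, hj]
        by_cases hjK : lev j = K
        · have h6 := hu ⟨j, hjK⟩ s (by simp only; omega)
          rw [← hvK j hjK s h2] at h6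
          have h7 : s + 1 = l (j + 1) - l j := by omega
          rw [h7, hun] at h6
          convert h6 using 2
          by_cases hK : lev (j + 1) = K
          · rw [hfirst hK, if_neg (by omega)]
          · rw [hvw _ (by rwa [h4]), h3]
        · rw [hvw (l j + s) (by rwa [hj])]
          by_cases hK : lev (j + 1) = K
          · rw [hfirst hK, if_pos (by omega), dist_self]
            exact hδ K
          · rw [hvw _ (by rwa [h4]), hw₃, dist_self]
            · exact hδ K
            · rw [hj]; omega
            · rw [h4]; omega
    obtain ⟨w', hw'₁, hw'₂, hw'₃⟩ := exists_orbit_on (hδ K) (hsh K)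
      (fun t => lev (seg t) < K + 1) v hv
    refine ⟨w', fun j hj t ht ht' => ?_, fun j hj t ht => ?_, hw'₂⟩
    · have hlt' : l j + t < l (j + 1) := by have := hN0 (lev j); omega
      have h1 : seg (l j + t) = j := hseg' _ _ (by omega) hlt'
      have h2 := hw'₃ (l j + t) (by rwa [h1])
      have h3 : dist (v (l j + t)) (f^[t] (x j)) ≤ 2 * (1 / 2) ^ lev j - 2 * (1 / 2) ^ K := by
        rcases (Nat.lt_succ_iff.1 hj).eq_or_lt with h4 | h4
        · have h5 := hux ⟨j, h4⟩ t (by rwa [← h4]) (by simp only; rw [h4] at ht'; omega)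
          rw [hvK j h4 t hlt', h5, h4]
          simp
        · rw [hvw _ (by rw [h1]; omega)]
          exact hw₁ j h4 t ht ht'
      have h4 := dist_triangle (w' (l j + t)) (v (l j + t)) (f^[t] (x j))
      rw [pow_succ]
      linarith
    · have h1 : seg (l j + t) = j := hseg' _ _ (by omega) ht
      rw [hw'₁ _ (by rw [h1]; omega), hvw _ (by rw [h1]; omega)]
      exact hw₂ j (by omega) t ht

/-- For levels truncated at `K` the gluing ends in a single true orbit. A limit of its initial
points as `K` grows exists by compactness and keeps all the estimates, since each is a closed
condition valid once `lev j ≤ K`. -/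
theorem Mixing.exists_glued [CompactSpace X] (hf : Continuous f) (hsh : Shadowing f)
    (h : Mixing f) : ∃ N : ℕ → ℕ, (∀ k, 0 < N k) ∧ ∀ lev l : ℕ → ℕ, l 0 = 0 →
      (∀ j, l j + 2 * N (lev j) ≤ l (j + 1)) → ∀ x : ℕ → X, ∃ z : X, ∀ j t,
        N (lev j) ≤ t → l j + t + N (lev j) ≤ l (j + 1) →
          dist (f^[l j + t] z) (f^[t] (x j)) ≤ 2 * (1 / 2) ^ lev j := by
  choose δ hδ hδs using fun k : ℕ => hsh ((1 / 2) ^ k) (by positivity)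
  choose M hM hMc using fun k => h.exists_forall_chain hf (hδ k)
  -- Partial sums make `N` monotone, so truncating the levels does not violate the gap condition.
  let N : ℕ → ℕ := fun k => ∑ i ∈ Finset.range (k + 1), M i
  have hMN : ∀ k, M k ≤ N k := fun k =>
    Finset.single_le_sum (f := M) (fun _ _ => Nat.zero_le _) (Finset.self_mem_range_succ k)
  have hN0 : ∀ k, 0 < N k := fun k => (hM k).trans_le (hMN k)
  have hmono : Monotone N := fun a b hab =>
    Finset.sum_le_sum_of_subset (Finset.range_subset_range.2 (by omega))
  refine ⟨N, hN0, fun lev l hl0 hl x => ?_⟩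
  have hstrict : StrictMono l := strictMono_nat_of_lt_succ fun j => by
    have := hl j
    have := hN0 (lev j)
    omega
  obtain ⟨seg, hseg, hseg'⟩ := StrictMono.exists_index hstrict hl0
  have hz : ∀ K : ℕ, ∃ z : X, ∀ j t, lev j ≤ K →
        N (lev j) ≤ t → l j + t + N (lev j) ≤ l (j + 1) →
          dist (f^[l j + t] z) (f^[t] (x j)) ≤ 2 * (1 / 2) ^ lev j := by
    intro K
    obtain ⟨w, hw₁, -, hw₃⟩ := exists_glued_below hδ hδs hN0
      (fun k n hn => hMc k n ((hMN k).trans hn)) (fun j => min (lev j) K) l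
      (fun j => le_trans (by have := hmono (min_le_left (lev j) K); omega) (hl j)) x hseg hseg'
      (K + 1)
    have hw : ∀ t, f^[t] (w 0) = w t := by
      intro t
      induction t with
      | zero => rfl
      | succ t ih =>
        rw [Function.iterate_succ_apply', ih]
        exact hw₃ t (Nat.lt_succ_iff.2 (min_le_right _ _)) (Nat.lt_succ_iff.2 (min_le_right _ _))
    refine ⟨w 0, fun j t hj ht ht' => ?_⟩
    have h1 := hw₁ j (Nat.lt_succ_iff.2 (min_le_right _ _)) t (by rwa [min_eq_left hj])
      (by rwa [min_eq_left hj])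
    rw [hw]
    rw [min_eq_left hj] at h1
    have h2 : (0 : ℝ) < (1 / 2) ^ (K + 1) := by positivity
    linarith
  choose z hz using hz
  obtain ⟨a, -, ha⟩ := isCompact_univ.ultrafilter_le_nhds
    ((hyperfilter ℕ : Ultrafilter ℕ).map z) (by simp)
  have ha' : Tendsto z (hyperfilter ℕ : Ultrafilter ℕ) (𝓝 a) := ha
  refine ⟨a, fun j t ht ht' => ?_⟩
  refine le_of_tendsto ((((hf.iterate (l j + t)).tendsto a).comp ha').dist tendsto_const_nhds) ?_
  refine (Nat.hyperfilter_le_atTop : ((hyperfilter ℕ : Ultrafilter ℕ) : Filter ℕ) ≤ atTop) ?_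
  filter_upwards [eventually_ge_atTop (lev j)] with K hK
  exact hz K j t hK ht ht'

/-- Mistakes occur only in the transitions at the two ends of a segment, so for each `ε` the mistake
function is constant in `n`. -/
theorem Mixing.almostSpecification [CompactSpace X] (hf : Continuous f) (hsh : Shadowing f)
    (h : Mixing f) : AlmostSpecification f := by
  obtain ⟨N, hN0, hglue⟩ := h.exists_glued hf hsh
  have hlev : ∀ ε : ℝ, ∃ k : ℕ, 0 < ε → 2 * (1 / 2 : ℝ) ^ k < ε := by
    intro ε
    by_cases hε : 0 < ε
    · obtain ⟨k, hk⟩ := exists_pow_lt_of_lt_one (half_pos hε) (by norm_num : (1 / 2 : ℝ) < 1)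
      exact ⟨k, fun _ => by linarith⟩
    · exact ⟨0, fun h => absurd h hε⟩
  choose c hc using hlev
  refine ⟨1, fun _ ε => 2 * N (c ε), fun ε => 2 * N (c (min ε 1)) + 1,
    ⟨one_pos, fun ε _ _ => ⟨fun _ _ => le_rfl, tendsto_const_div_atTop_nhds_zero_nat _⟩⟩,
    fun ε _ n hn => hn, fun m ε x n hm hε hn => ?_⟩
  -- The gluing needs infinitely many segments; the last one is repeated.
  let r : ℕ → ℕ := fun j => min j (m - 1)
  have hr : ∀ j, r j < m := fun j => by simp only [r]; omega
  have hrj : ∀ j, j < m → r j = j := fun j hj => by simp only [r]; omega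
  let l : ℕ → ℕ := fun j => ∑ s ∈ Finset.range j, n (r s)
  have hl : ∀ j, l (j + 1) = l j + n (r j) := fun j => Finset.sum_range_succ _ _
  obtain ⟨z, hz⟩ := hglue (fun j => c (min (ε (r j)) 1)) l rfl
    (fun j => by have := hn _ (hr j); simp only at this; rw [hl]; omega) (fun j => x (r j))
  refine ⟨z, fun j hj => ?_⟩
  set q := N (c (min (ε j) 1)) with hq
  have hlj : ∑ s ∈ Finset.range j, n s = l j := Finset.sum_congr rfl fun s hs => by
    rw [hrj s ((Finset.mem_range.1 hs).trans hj)]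
  refine ⟨Finset.Ico q (n j - q), fun i hi => ?_, ?_, fun i hi => ?_⟩
  · have := Finset.mem_Ico.1 hi
    exact Finset.mem_range.2 (by omega)
  · rw [Nat.card_Ico]
    simp only [mistakeExt]
    omega
  · have hi' := Finset.mem_Ico.1 hi
    have h1 := hz j i (by simp only [hrj j hj]; omega) (by
      rw [hl]
      simp only [hrj j hj]
      omega)
    rw [hlj, ← Function.iterate_add_apply, add_comm i, dist_comm]
    simp only [hrj j hj] at h1
    exact (h1.trans_lt (hc _ (lt_min (hε j hj) one_pos))).trans_le (min_le_left _ _)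

end Gluing

/-! ### From mixing to the average shadowing properties -/

section MixingAverageShadowing

variable {X : Type*} [MetricSpace X] {f : X → X}

/-- Finite pseudo-orbits with small errors are close to orbits. -/
theorem exists_forall_dist_iterate_lt [CompactSpace X] (hf : Continuous f) (n : ℕ) {ε : ℝ}
    (hε : 0 < ε) : ∃ η > 0, ∀ u : ℕ → X, (∀ i < n, dist (f (u i)) (u (i + 1)) < η) →
      ∀ t ≤ n, dist (f^[t] (u 0)) (u t) < ε := by
  induction n generalizing ε with
  | zero =>
    refine ⟨1, one_pos, fun u _ t ht => ?_⟩
    simpa [Nat.le_zero.1 ht] using hε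
  | succ n ih =>
    obtain ⟨θ, hθ, hfθ⟩ := Metric.uniformContinuous_iff.1
      (CompactSpace.uniformContinuous_of_continuous hf) (ε / 2) (by positivity)
    obtain ⟨η, hη, hu⟩ := ih (lt_min hθ hε)
    refine ⟨min η (ε / 2), by positivity, fun u hi t ht => ?_⟩
    have h1 := hu u fun i hin => (hi i (by omega)).trans_le (min_le_left _ _)
    rcases ht.eq_or_lt with rfl | ht
    · have h2 := hfθ ((h1 n le_rfl).trans_le (min_le_left _ _))
      have h3 := (hi n (by omega)).trans_le (min_le_right _ _)
      rw [← Function.iterate_succ_apply' f] at h2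
      linarith [dist_triangle (f^[n + 1] (u 0)) (f (u n)) (u (n + 1))]
    · exact (h1 t (by omega)).trans_le (min_le_right _ _)

/-- At most `2 * q` times near the ends escape the bound by `h`. Partial sums with `m ≤ n` are
allowed because averages may stop inside a block. -/
theorem sum_range_le_add_edges {D : ℝ} (hD : 0 ≤ D) {e h : ℕ → ℝ} {q n m : ℕ} (hm : m ≤ n)
    (he : ∀ t, e t ≤ D) (hh : ∀ t, 0 ≤ h t) (heh : ∀ t, q ≤ t → t + q ≤ n → e t ≤ h t) :
    ∑ t ∈ Finset.range m, e t ≤ ∑ t ∈ Finset.range m, h t + 2 * q * D := by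
  have h1 : ∀ t ∈ Finset.range m, e t ≤ h t + if t < q ∨ n < t + q then D else 0 := by
    intro t _
    split_ifs with ht
    · linarith [he t, hh t]
    · push Not at ht
      linarith [heh t ht.1 ht.2]
  refine (Finset.sum_le_sum h1).trans ?_
  rw [Finset.sum_add_distrib, ← Finset.sum_filter, Finset.sum_const, nsmul_eq_mul]
  gcongr
  have h2 : (Finset.range m).filter (fun t => t < q ∨ n < t + q) ⊆
      Finset.range q ∪ Finset.Ico (n - q) n := by
    intro t ht
    simp only [Finset.mem_filter, Finset.mem_range, Finset.mem_union, Finset.mem_Ico] at ht ⊢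
    omega
  have h3 : ((Finset.range m).filter (fun t => t < q ∨ n < t + q)).card ≤ 2 * q := by
    refine (Finset.card_le_card h2).trans ((Finset.card_union_le _ _).trans ?_)
    rw [Finset.card_range, Nat.card_Ico]
    omega
  exact_mod_cast h3

/-- In blocks of fixed length `n`, `z` traces the orbit of the block's first point. If all errors in
a block are below `η`, then `x` stays near that orbit too; otherwise the block costs at most `n *
D`, which is charged to its error sum, at least `η`. -/
theorem Mixing.exists_average_shadowing [CompactSpace X] (hf : Continuous f) (hsh : Shadowing f)
    (h : Mixing f) {ε : ℝ} (hε : 0 < ε) : ∃ δ > 0, ∀ x : ℕ → X,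
      (∀ᶠ n : ℕ in atTop,
        (1 / (n : ℝ)) * ∑ i ∈ Finset.range n, dist (f (x i)) (x (i + 1)) < δ) →
      ∃ y : X, ∀ᶠ n : ℕ in atTop,
        (1 / (n : ℝ)) * ∑ i ∈ Finset.range n, dist (f^[i] y) (x i) ≤ ε := by
  obtain ⟨D, hD, hDX⟩ := exists_dist_le (X := X)
  obtain ⟨N, hN0, hglue⟩ := h.exists_glued hf hsh
  -- Tracing costs `2 * (1 / 2) ^ c < ε / 16`, following the pseudo-orbit `ε / 16`, and the block
  -- ends `ε / 8` per unit time: `ε / 4` in all on a good block.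
  obtain ⟨c, hc⟩ := exists_pow_lt_of_lt_one (show 0 < ε / 32 by positivity)
    (by norm_num : (1 / 2 : ℝ) < 1)
  set q := N c with hq
  obtain ⟨n, hn⟩ := exists_nat_ge (max (2 * q : ℝ) (2 * q * D / (ε / 8)))
  have hn1 : 2 * q ≤ n := by exact_mod_cast (le_max_left _ _).trans hn
  have hn2 : 2 * q * D ≤ n * (ε / 8) :=
    (div_le_iff₀ (by positivity)).1 ((le_max_right _ _).trans hn)
  have hn0 : 0 < n := by have := hN0 c; omega
  have hn0' : (0 : ℝ) < n := by exact_mod_cast hn0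
  obtain ⟨η, hη, hfollow⟩ := exists_forall_dist_iterate_lt hf n (show 0 < ε / 16 by positivity)
  refine ⟨ε * η / (4 * n * D), by positivity, fun x hx => ?_⟩
  obtain ⟨z, hz⟩ := hglue (fun _ => c) (fun j => j * n) (by simp)
    (fun j => by simp only [Nat.succ_mul]; omega) (fun j => x (j * n))
  refine ⟨z, ?_⟩
  let e : ℕ → ℝ := fun i => dist (f^[i] z) (x i)
  let r : ℕ → ℝ := fun i => dist (f (x i)) (x (i + 1))
  have hblock : ∀ j, ∑ t ∈ Finset.range n, e (j * n + t) ≤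
      n * (ε / 4) + n * D / η * ∑ t ∈ Finset.range n, r (j * n + t) := by
    intro j
    have hr0 : 0 ≤ ∑ t ∈ Finset.range n, r (j * n + t) :=
      Finset.sum_nonneg fun _ _ => dist_nonneg
    by_cases hgood : ∀ i < n, r (j * n + i) < η
    · have h1 := sum_range_le_add_edges hD.le (e := fun t => e (j * n + t)) (h := fun _ => ε / 8)
        (q := q) (le_refl n) (fun _ => hDX _ _) (fun _ => by positivity) (fun t ht ht' => by
          have h2 := hz j t ht (by rw [Nat.succ_mul]; omega)
          have h3 := hfollow (fun i => x (j * n + i)) hgood t (by omega)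
          have h4 := dist_triangle (f^[j * n + t] z) (f^[t] (x (j * n))) (x (j * n + t))
          simp only [add_zero] at h3
          simp only [e]
          linarith)
      simp only [Finset.sum_const, Finset.card_range, nsmul_eq_mul] at h1
      have h2 : 0 ≤ n * D / η * ∑ t ∈ Finset.range n, r (j * n + t) := by positivity
      linarith
    · push Not at hgood
      obtain ⟨i, hi, hir⟩ := hgood
      have h1 : η ≤ ∑ t ∈ Finset.range n, r (j * n + t) :=
        hir.trans (Finset.single_le_sum (f := fun t => r (j * n + t))
          (fun _ _ => dist_nonneg) (Finset.mem_range.2 hi))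
      have h2 : ∑ t ∈ Finset.range n, e (j * n + t) ≤ n * D := by
        simpa using Finset.sum_le_card_nsmul (Finset.range n) (fun t => e (j * n + t)) D
          fun _ _ => hDX _ _
      have h3 : n * D ≤ n * D / η * ∑ t ∈ Finset.range n, r (j * n + t) := by
        rw [div_mul_eq_mul_div, le_div_iff₀ hη]
        gcongr
      have h4 : 0 ≤ n * (ε / 4) := by positivity
      linarith
  have hblocks : ∀ Q : ℕ, ∑ i ∈ Finset.range (Q * n), e i ≤
      (Q * n : ℕ) * (ε / 4) + n * D / η * ∑ i ∈ Finset.range (Q * n), r i := by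
    intro Q
    induction Q with
    | zero => simp
    | succ Q ih =>
      rw [Nat.succ_mul, Finset.sum_range_add, Finset.sum_range_add, mul_add]
      have := hblock Q
      push_cast at ih ⊢
      linarith
  obtain ⟨M, hM⟩ := eventually_atTop.1 hx
  refine eventually_atTop.2 ⟨M + n, fun m hm => ?_⟩
  have hm0 : (0 : ℝ) < m := by exact_mod_cast (show 0 < m by omega)
  rw [one_div, inv_mul_le_iff₀ hm0]
  -- Rounding `m` up to whole blocks at most doubles it, which turns the bound `ε / 2` into `ε`.
  have h1 : m ≤ (m / n + 1) * n := by
    rw [mul_comm]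
    exact (Nat.lt_mul_div_succ m hn0).le
  have h2 : (m / n + 1) * n ≤ 2 * m := by
    have := Nat.div_mul_le_self m n
    rw [Nat.succ_mul]
    omega
  set Q := m / n + 1
  have h3 := hM (Q * n) (by omega)
  have hQ0 : (0 : ℝ) < (Q * n : ℕ) := by exact_mod_cast (show 0 < Q * n by omega)
  rw [one_div, inv_mul_lt_iff₀ hQ0] at h3
  have h4 : n * D / η * ∑ i ∈ Finset.range (Q * n), r i ≤ (Q * n : ℕ) * (ε / 4) :=
    calc n * D / η * ∑ i ∈ Finset.range (Q * n), r i
        ≤ n * D / η * ((Q * n : ℕ) * (ε * η / (4 * n * D))) := by gcongr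
      _ = _ := by field_simp
  have h5 : ∑ i ∈ Finset.range m, e i ≤ ∑ i ∈ Finset.range (Q * n), e i :=
    Finset.sum_le_sum_of_subset_of_nonneg (Finset.range_subset_range.2 h1)
      fun _ _ _ => dist_nonneg
  have h6 : ((Q * n : ℕ) : ℝ) ≤ 2 * m := by exact_mod_cast h2
  have h7 : ((Q * n : ℕ) : ℝ) * (ε / 2) ≤ 2 * m * (ε / 2) := by gcongr
  linarith [hblocks Q]

theorem Mixing.averageShadowing [CompactSpace X] (hf : Continuous f) (hsh : Shadowing f)
    (h : Mixing f) : AverageShadowing f := by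
  intro ε hε
  obtain ⟨δ, hδ, hδx⟩ := h.exists_average_shadowing hf hsh (half_pos hε)
  refine ⟨δ, hδ, fun x ⟨N, _, hN⟩ => ?_⟩
  obtain ⟨y, hy⟩ := hδx x (eventually_atTop.2 ⟨N, fun n hn => by simpa using hN n 0 hn⟩)
  exact ⟨y, shadowedInAverage_of_eventually (half_lt_self hε) hy⟩

/-- A point `y k` shadows `x` with average error `(1 / 2) ^ k` from time `M k` on. The orbit of `z`
follows that of `y k` on `[T k, T (k + 1))` up to transitions, and `T` grows so fast that the past
and the transitions are negligible. -/
theorem Mixing.asymptoticAverageShadowing [CompactSpace X] (hf : Continuous f)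
    (hsh : Shadowing f) (h : Mixing f) : AsymptoticAverageShadowing f := by
  intro x hx
  obtain ⟨D, hD, hDX⟩ := exists_dist_le (X := X)
  obtain ⟨N, hN0, hglue⟩ := h.exists_glued hf hsh
  have hy : ∀ k : ℕ, ∃ (y : X) (M : ℕ), ∀ n ≥ M,
      ∑ i ∈ Finset.range n, dist (f^[i] y) (x i) ≤ n * (1 / 2) ^ k := by
    intro k
    obtain ⟨δ, hδ, hδx⟩ := h.exists_average_shadowing hf hsh
      (show (0 : ℝ) < (1 / 2) ^ k by positivity)
    obtain ⟨y, hy⟩ := hδx x (hx.eventually_lt_const hδ)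
    obtain ⟨M, hM⟩ := eventually_atTop.1 hy
    refine ⟨y, M + 1, fun n hn => ?_⟩
    have hn0 : (0 : ℝ) < n := by exact_mod_cast (show 0 < n by omega)
    have := hM n (by omega)
    rwa [one_div, inv_mul_le_iff₀ hn0] at this
  choose y M hM using hy
  obtain ⟨T, hT0, hT⟩ : ∃ T : ℕ → ℕ, T 0 = 0 ∧ ∀ k, T (k + 1) =
      T k + 2 * N k + M k + M (k + 1) + 2 ^ (k + 1) * (T k + 2 * N k + 2 * N (k + 1)) :=
    ⟨fun k => Nat.rec 0 (fun k T => T + 2 * N k + M k + M (k + 1) +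
      2 ^ (k + 1) * (T + 2 * N k + 2 * N (k + 1))) k, rfl, fun _ => rfl⟩
  have hT1 : ∀ k, T k + 2 * N k ≤ T (k + 1) := fun k => by rw [hT]; omega
  have hstrict : StrictMono T := strictMono_nat_of_lt_succ fun k => by
    have := hT1 k
    have := hN0 k
    omega
  have hT2 : ∀ k : ℕ, (T k : ℝ) + 2 * N k + 2 * N (k + 1) ≤ (1 / 2) ^ (k + 1) * T (k + 1) := by
    intro k
    rw [one_div, inv_pow, inv_mul_eq_div, le_div_iff₀ (by positivity), mul_comm]
    exact_mod_cast (show 2 ^ (k + 1) * (T k + 2 * N k + 2 * N (k + 1)) ≤ T (k + 1) by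
      rw [hT]; omega)
  obtain ⟨z, hz⟩ := hglue id T hT0 hT1 fun k => f^[T k] (y k)
  let A : ℕ → ℝ := fun n => ∑ i ∈ Finset.range n, dist (f^[i] z) (x i)
  have hA : ∀ k n, T k ≤ n → n ≤ T (k + 1) → M k ≤ n →
      A n ≤ A (T k) + 3 * (1 / 2) ^ k * n + 2 * N k * D := by
    intro k n hn hn' hnM
    obtain ⟨s, rfl⟩ := Nat.exists_eq_add_of_le hn
    have h1 := sum_range_le_add_edges hD.le (e := fun t => dist (f^[T k + t] z) (x (T k + t)))
      (h := fun t => 2 * (1 / 2) ^ k + dist (f^[T k + t] (y k)) (x (T k + t))) (q := N k)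
      (n := T (k + 1) - T k) (m := s) (by omega) (fun _ => hDX _ _) (fun _ => by positivity)
      (fun t ht ht' => by
        have h2 := hz k t ht (by simp only [id]; omega)
        rw [← Function.iterate_add_apply, add_comm t] at h2
        exact (dist_triangle _ _ _).trans (add_le_add_left h2 _))
    have h2 := hM k (T k + s) hnM
    rw [Finset.sum_range_add] at h2
    have h3 : 0 ≤ ∑ i ∈ Finset.range (T k), dist (f^[i] (y k)) (x i) :=
      Finset.sum_nonneg fun _ _ => dist_nonneg
    rw [Finset.sum_add_distrib, Finset.sum_const, Finset.card_range, nsmul_eq_mul] at h1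
    have h4 : (s : ℝ) * (2 * (1 / 2) ^ k) ≤ (T k + s : ℕ) * (2 * (1 / 2) ^ k) := by
      gcongr
      omega
    have h5 : A (T k + s) = A (T k) +
        ∑ t ∈ Finset.range s, dist (f^[T k + t] z) (x (T k + t)) := Finset.sum_range_add _ _ _
    rw [h5]
    linarith
  have hA0 : ∀ n, A n ≤ n * D := fun n => by
    simpa using Finset.sum_le_card_nsmul (Finset.range n) (fun i => dist (f^[i] z) (x i)) D
      fun _ _ => hDX _ _
  -- Times before `T k` are bounded trivially by `D`. Blocks `k` and `k + 1` contribute the factors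
  -- `3 * (1 / 2) ^ k` and `3 * (1 / 2) ^ (k + 1)`, together `9 * (1 / 2) ^ (k + 1)`.
  have hA1 : ∀ k n, T (k + 1) ≤ n → n ≤ T (k + 2) →
      A n ≤ n * ((1 / 2) ^ (k + 1) * (2 * D + 9)) := by
    intro k n hn hn'
    have h1 := hA (k + 1) n hn hn' (le_trans (by rw [hT]; omega) hn)
    have h2 := hA k (T (k + 1)) (hstrict k.lt_succ_self).le le_rfl (by rw [hT]; omega)
    have h3 := hA0 (T k)
    have h4 := mul_le_mul_of_nonneg_right (hT2 k) hD.le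
    have h5 : (1 / 2 : ℝ) ^ (k + 1) * T (k + 1) ≤ (1 / 2) ^ (k + 1) * n := by gcongr
    have h6 := mul_le_mul_of_nonneg_right h5 hD.le
    have h7 : (1 / 2 : ℝ) ^ k = 2 * (1 / 2) ^ (k + 1) := by rw [pow_succ]; ring
    have h8 : 0 ≤ (n : ℝ) * ((1 / 2) ^ (k + 1) * D) := by positivity
    rw [h7] at h2
    linarith
  obtain ⟨seg, hseg, -⟩ := StrictMono.exists_index hstrict hT0
  refine ⟨z, Metric.tendsto_atTop.2 fun ε hε => ?_⟩
  obtain ⟨k, hk⟩ := exists_pow_lt_of_lt_one (show 0 < ε / (2 * D + 9) by positivity)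
    (by norm_num : (1 / 2 : ℝ) < 1)
  refine ⟨T (k + 1), fun n hn => ?_⟩
  rw [Real.dist_0_eq_abs, abs_of_nonneg (average_nonneg (fun _ => dist_nonneg) n)]
  have hn0 : (0 : ℝ) < n := by
    exact_mod_cast lt_of_lt_of_le (lt_of_le_of_lt (Nat.zero_le _) (hstrict k.lt_succ_self)) hn
  obtain ⟨h1, h2⟩ := hseg n
  have h3 : k + 1 < seg n + 1 := hstrict.lt_iff_lt.1 (hn.trans_lt h2)
  obtain ⟨s, hs⟩ := Nat.exists_eq_add_of_le' (show 1 ≤ seg n by omega)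
  rw [hs] at h1 h2 h3
  have h4 := hA1 s n h1 h2.le
  rw [one_div, inv_mul_lt_iff₀ hn0]
  refine h4.trans_lt ?_
  gcongr
  rw [lt_div_iff₀ (by positivity)] at hk
  refine lt_of_le_of_lt ?_ hk
  gcongr ?_ * _
  exact pow_le_pow_of_le_one (by norm_num) (by norm_num) (by omega)

end MixingAverageShadowing

end ShadowingDynamics

/-! ### The equivalences, all through mixing -/

theorem mainTheorem10 {X : Type*} [MetricSpace X] [CompactSpace X] (f : X → X)
    (hf : Continuous f) (hsh : ShadowingDynamics.Shadowing f) :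
    List.TFAE
      [ShadowingDynamics.TotallyTransitive f,
       ShadowingDynamics.WeaklyMixing f,
       ShadowingDynamics.Mixing f,
       Function.Surjective f ∧ ShadowingDynamics.Specification f,
       Function.Surjective f ∧ ShadowingDynamics.AlmostSpecification f,
       Function.Surjective f ∧ ShadowingDynamics.AsymptoticAverageShadowing f,
       Function.Surjective f ∧ ShadowingDynamics.AverageShadowing f] ∧
    (ShadowingDynamics.CExpansive f →
      List.TFAE
        [ShadowingDynamics.TotallyTransitive f,
         ShadowingDynamics.WeaklyMixing f,
         ShadowingDynamics.Mixing f,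
         Function.Surjective f ∧ ShadowingDynamics.Specification f,
         Function.Surjective f ∧ ShadowingDynamics.AlmostSpecification f,
         Function.Surjective f ∧ ShadowingDynamics.AsymptoticAverageShadowing f,
         Function.Surjective f ∧ ShadowingDynamics.AverageShadowing f,
         ShadowingDynamics.PeriodicSpecification f]) := by
  have h₁₃ := fun h : ShadowingDynamics.TotallyTransitive f => (h.chainMixing hf).mixing hsh
  have h₂₃ := fun h : ShadowingDynamics.WeaklyMixing f => (h.chainMixing hf).mixing hsh
  have h₃₁ := fun h : ShadowingDynamics.Mixing f => h.totallyTransitive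
  have h₃₂ := fun h : ShadowingDynamics.Mixing f => h.weaklyMixing
  have h₃₄ := fun h : ShadowingDynamics.Mixing f =>
    And.intro (h.surjective hf) (h.specification hf hsh)
  have h₄₃ := fun h : Function.Surjective f ∧ ShadowingDynamics.Specification f =>
    h.2.mixing h.1
  have h₃₅ := fun h : ShadowingDynamics.Mixing f =>
    And.intro (h.surjective hf) (h.almostSpecification hf hsh)
  have h₅₃ := fun h : Function.Surjective f ∧ ShadowingDynamics.AlmostSpecification f =>
    (h.2.chainMixing hf h.1).mixing hsh
  have h₃₆ := fun h : ShadowingDynamics.Mixing f =>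
    And.intro (h.surjective hf) (h.asymptoticAverageShadowing hf hsh)
  have h₆₃ := fun h : Function.Surjective f ∧ ShadowingDynamics.AsymptoticAverageShadowing f =>
    (h.2.weakAverageShadowing.chainMixing hf h.1).mixing hsh
  have h₃₇ := fun h : ShadowingDynamics.Mixing f =>
    And.intro (h.surjective hf) (h.averageShadowing hf hsh)
  have h₇₃ := fun h : Function.Surjective f ∧ ShadowingDynamics.AverageShadowing f =>
    (h.2.weakAverageShadowing.chainMixing hf h.1).mixing hsh
  refine ⟨?_, fun he => ?_⟩
  · tfae_have 1 → 3 := h₁₃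
    tfae_have 2 → 3 := h₂₃
    tfae_have 3 → 1 := h₃₁
    tfae_have 3 → 2 := h₃₂
    tfae_have 3 → 4 := h₃₄
    tfae_have 4 → 3 := h₄₃
    tfae_have 3 → 5 := h₃₅
    tfae_have 5 → 3 := h₅₃
    tfae_have 3 → 6 := h₃₆
    tfae_have 6 → 3 := h₆₃
    tfae_have 3 → 7 := h₃₇
    tfae_have 7 → 3 := h₇₃
    tfae_finish
  · tfae_have 1 → 3 := h₁₃
    tfae_have 2 → 3 := h₂₃
    tfae_have 3 → 1 := h₃₁
    tfae_have 3 → 2 := h₃₂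
    tfae_have 3 → 4 := h₃₄
    tfae_have 4 → 3 := h₄₃
    tfae_have 3 → 5 := h₃₅
    tfae_have 5 → 3 := h₅₃
    tfae_have 3 → 6 := h₃₆
    tfae_have 6 → 3 := h₆₃
    tfae_have 3 → 7 := h₃₇
    tfae_have 7 → 3 := h₇₃
    tfae_have 3 → 8 := fun h => h.periodicSpecification hf hsh he
    tfae_have 8 → 3 := fun h => h.specification.mixing (h.surjective hf)
    tfae_finish
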